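/- Let $1\le p\le 2$, let $\sigma_1,\sigma_2\in L^p[0,1]$ be complex-valued, let $P=(p_{jk})$ be a $2\times 2$ matrix function with entries in $L^p[0,1]$, and let $r\ge 0$. For $\mu\in\mathbb C$ put \[ J(x)=\begin{bmatrix}0&\sigma_1(x)\\ \sigma_2(x)&0\end{bmatrix},\qquad A_\mu=i\mu\begin{bmatrix}1&0\\0&-1\end{bmatrix},\qquad \Sigma_r=\{\mu\in\mathbb C:\ \operatorname{Im}\mu>-r\}. \] Solutions of the systems below are absolutely continuous functions $Y:[0,1]\to\mathbb C^2$ satisfying the system for a.e. $x\in[0,1]$; a fundamental system is a pair of linearly independent solutions. Then there are constants $R>0$ and $C$ (depending on $\sigma_1,\sigma_2,P,r$) such that for every $\mu\in\Sigma_r$ with $|\mu|>R$ the following holds. 1. The Dirac system $Y'+J(x)Y=A_\mu Y$ has a unique solution $W=(w_1,w_2)^T$ with $w_1(0)=1$, $w_2(1)=0$ and a unique solution $V=(v_1,v_2)^T$ with $v_1(0)=0$, $v_2(1)=1$; they form a fundamental system, and $v_2(0)\neq 0$. 2. Let $D=[W,V]$ be the matrix with columns $W,V$, and for $Z=(z_1,z_2)^T$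 put \[ Q_1(Z)=(v_2p_{11}-v_1p_{21})z_1+(v_2p_{12}-v_1p_{22})z_2,\qquad Q_2(Z)=(-w_2p_{11}+w_1p_{21})z_1+(-w_2p_{12}+w_1p_{22})z_2, \] \[ (\mathcal A_1Z)(x)=\frac{e^{-i\mu x}}{v_2(0)}D(x)\begin{bmatrix}\int_0^x e^{i\mu t}Q_1(Z)(t)\,dt\\ -\int_x^1 e^{i\mu t}Q_2(Z)(t)\,dt\end{bmatrix},\qquad (\mathcal A_2Z)(x)=\frac{e^{-i\mu(1-x)}}{v_2(0)}D(x)\begin{bmatrix}\int_0^x e^{i\mu(1-t)}Q_1(Z)(t)\,dt\\ -\int_x^1 e^{i\mu(1-t)}Q_2(Z)(t)\,dt\end{bmatrix}. \] The perturbed system $Y'+J(x)Y=A_\mu Y+\frac{P(x)}{\mu}Y$ has a fundamental system $\widetilde W,\widetilde V$ such that for all $x\in[0,1]$ \[ \widetilde W(x)=W(x)+\frac{e^{i\mu x}}{\mu}\,\mathcal A_1\bigl(e^{-i\mu\,\cdot}W\bigr)(x)+e^{i\mu x}E_1(x,\mu), \] \[ \widetilde V(x)=V(x)+\frac{e^{i\mu(1-x)}}{\mu}\,\mathcal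 A_2\bigl(e^{-i\mu(1-\cdot)}V\bigr)(x)+e^{i\mu(1-x)}E_2(x,\mu), \] where $\|E_j(x,\mu)\|\le C|\mu|^{-2}$ for $j=1,2$. -/

import Mathlib

open Set MeasureTheory

noncomputable section

namespace DiracSystem

/-- The half-plane `Σ_r = {μ ∈ ℂ : Im μ > -r}`. -/
def halfPlane (r : ℝ) : Set ℂ := {μ : ℂ | -r < μ.im}

/-- The matrix `A_μ = iμ diag(1, -1)`. -/
def matA (μ : ℂ) : Matrix (Fin 2) (Fin 2) ℂ :=
  (Complex.I * μ) • !![1, 0; 0, -1]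

/-- The potential `J(x)`, off-diagonal with entries `σ₁(x)` and `σ₂(x)`. -/
def matJ (σ₁ σ₂ : ℝ → ℂ) (x : ℝ) : Matrix (Fin 2) (Fin 2) ℂ :=
  !![0, σ₁ x; σ₂ x, 0]

/-- `Y` is an absolutely continuous solution on `[0,1]` of the linear system
`Y'(x) = M(x) Y(x)` for a.e. `x ∈ [0,1]`. -/
def IsSolution (M : ℝ → Matrix (Fin 2) (Fin 2) ℂ) (Y : ℝ → Fin 2 → ℂ) : Prop :=
  AbsolutelyContinuousOnInterval Y 0 1 ∧
    ∀ᵐ x ∂(volume.restrict (Icc (0 : ℝ) 1)), HasDerivAt Y ((M x).mulVec (Y x)) x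

/-- `Y₁, Y₂` is a fundamental system of `Y' = M Y` on `[0,1]`: two solutions that are linearly
independent over `ℂ` as functions on `[0,1]`. -/
def IsFundamentalSystem (M : ℝ → Matrix (Fin 2) (Fin 2) ℂ) (Y₁ Y₂ : ℝ → Fin 2 → ℂ) : Prop :=
  IsSolution M Y₁ ∧ IsSolution M Y₂ ∧
    LinearIndependent ℂ ![(Icc (0 : ℝ) 1).domRestrict Y₁, (Icc (0 : ℝ) 1).domRestrict Y₂]

/-- Coefficient matrix of the Dirac system `Y' + J Y = A_μ Y`. -/
def diracCoeff (σ₁ σ₂ : ℝ → ℂ) (μ : ℂ) (x : ℝ) : Matrix (Fin 2) (Fin 2) ℂ :=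
  matA μ - matJ σ₁ σ₂ x

/-- Coefficient matrix of the perturbed Dirac system `Y' + J Y = A_μ Y + (P / μ) Y`. -/
def perturbedCoeff (σ₁ σ₂ : ℝ → ℂ) (P : ℝ → Matrix (Fin 2) (Fin 2) ℂ) (μ : ℂ) (x : ℝ) :
    Matrix (Fin 2) (Fin 2) ℂ :=
  matA μ - matJ σ₁ σ₂ x + μ⁻¹ • P x

/-- `W` solves the Dirac system with `w₁(0) = 1`, `w₂(1) = 0`. -/
def IsSolutionW (σ₁ σ₂ : ℝ → ℂ) (μ : ℂ) (W : ℝ → Fin 2 → ℂ) : Prop :=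
  IsSolution (diracCoeff σ₁ σ₂ μ) W ∧ W 0 0 = 1 ∧ W 1 1 = 0

/-- `V` solves the Dirac system with `v₁(0) = 0`, `v₂(1) = 1`. -/
def IsSolutionV (σ₁ σ₂ : ℝ → ℂ) (μ : ℂ) (V : ℝ → Fin 2 → ℂ) : Prop :=
  IsSolution (diracCoeff σ₁ σ₂ μ) V ∧ V 0 0 = 0 ∧ V 1 1 = 1

/-- `D(x) = [W(x), V(x)]`, the matrix with columns `W(x)` and `V(x)`. -/
def matD (W V : ℝ → Fin 2 → ℂ) (x : ℝ) : Matrix (Fin 2) (Fin 2) ℂ :=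
  !![W x 0, V x 0; W x 1, V x 1]

/-- `Q₁(Z) = (v₂ p₁₁ - v₁ p₂₁) z₁ + (v₂ p₁₂ - v₁ p₂₂) z₂`. -/
def Q₁ (P : ℝ → Matrix (Fin 2) (Fin 2) ℂ) (V Z : ℝ → Fin 2 → ℂ) (t : ℝ) : ℂ :=
  (V t 1 * P t 0 0 - V t 0 * P t 1 0) * Z t 0 + (V t 1 * P t 0 1 - V t 0 * P t 1 1) * Z t 1

/-- `Q₂(Z) = (-w₂ p₁₁ + w₁ p₂₁) z₁ + (-w₂ p₁₂ + w₁ p₂₂) z₂`. -/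
def Q₂ (P : ℝ → Matrix (Fin 2) (Fin 2) ℂ) (W Z : ℝ → Fin 2 → ℂ) (t : ℝ) : ℂ :=
  (-W t 1 * P t 0 0 + W t 0 * P t 1 0) * Z t 0 + (-W t 1 * P t 0 1 + W t 0 * P t 1 1) * Z t 1

/-- `(𝒜₁ Z)(x) = (e^{-iμx} / v₂(0)) D(x) (∫₀ˣ e^{iμt} Q₁(Z)(t) dt, -∫ₓ¹ e^{iμt} Q₂(Z)(t) dt)ᵀ`. -/
def opA₁ (P : ℝ → Matrix (Fin 2) (Fin 2) ℂ) (μ : ℂ) (W V Z : ℝ → Fin 2 → ℂ) (x : ℝ) :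
    Fin 2 → ℂ :=
  (Complex.exp (-Complex.I * μ * x) / V 0 1) • (matD W V x).mulVec
    ![∫ t in (0 : ℝ)..x, Complex.exp (Complex.I * μ * t) * Q₁ P V Z t,
      -∫ t in x..(1 : ℝ), Complex.exp (Complex.I * μ * t) * Q₂ P W Z t]

/-- `(𝒜₂ Z)(x) = (e^{-iμ(1-x)} / v₂(0)) D(x)
(∫₀ˣ e^{iμ(1-t)} Q₁(Z)(t) dt, -∫ₓ¹ e^{iμ(1-t)} Q₂(Z)(t) dt)ᵀ`. -/
def opA₂ (P : ℝ → Matrix (Fin 2) (Fin 2) ℂ) (μ : ℂ) (W V Z : ℝ → Fin 2 → ℂ) (x : ℝ) :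
    Fin 2 → ℂ :=
  (Complex.exp (-Complex.I * μ * (1 - x)) / V 0 1) • (matD W V x).mulVec
    ![∫ t in (0 : ℝ)..x, Complex.exp (Complex.I * μ * (1 - t)) * Q₁ P V Z t,
      -∫ t in x..(1 : ℝ), Complex.exp (Complex.I * μ * (1 - t)) * Q₂ P W Z t]

end DiracSystem

end

/-! Everything rests on two fixed-point problems, both contractions with factor 1/2 once `|μ|` is
large. Through `L^p ⊂ L^1` on `[0,1]`, only integrability of the coefficients enters.

Unperturbed system: writing `W = e^{iμx}(u₁, u₂)` turns the boundary problem into `u₁ = 1 - ∫₀ˣ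
σ₁u₂`, `u₂ = ∫ₓ¹ e^{2iμ(s-x)} σ₂u₁`. The kernel is bounded by `e^{2r}` but not small; its smallness
comes from oscillation, by a Riemann–Lebesgue estimate uniform in the half-plane and in the
endpoints (`exists_norm_integral_exp_kernel_mul_le`), carried over to `σ₂u₁` by parts. Hence `u₁` is
near `1` and `u₂` near `0`, which bounds `W` by `2|e^{iμx}|` and `w₁(1)` from below. The reflection
`x ↦ 1 - x` yields `V`, with a lower bound for `v₂(0)`. The coefficient matrix has trace zero, so
`det D` is the constant `v₂(0)`; as it is nonzero, uniqueness follows.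

Perturbed system: variation of constants gives `z = G + μ⁻¹𝒜z` for `z` the solution divided by its
exponential weight. The growth of `W`, `V` and the weight cancels in `𝒜`, so `‖𝒜‖ ≤ K` with `K`
independent of `μ` (`norm_weightedOp_le`). Stopping the Neumann series after the linear term costs
`O(|μ|⁻²)`. The weights `e^{iμx}` and `e^{iμ(1-x)}` are treated together. -/

noncomputable section

namespace DiracSystem

/-! ### Calculus of absolutely continuous functions on `[0,1]` -/

/-- `f` is absolutely continuous on `[0,1]` with integrable a.e. derivative `f'`. -/
structure HasACDeriv (f f' : ℝ → ℂ) : Prop where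
  ac : AbsolutelyContinuousOnInterval f 0 1
  int : IntervalIntegrable f' volume 0 1
  deriv : ∀ᵐ x, x ∈ Icc (0 : ℝ) 1 → HasDerivAt f (f' x) x

lemma uIcc_zero_one : uIcc (0 : ℝ) 1 = Icc 0 1 := uIcc_of_le zero_le_one

/-- Equality of two functions on `[0,1]` transfers two-sided derivatives only at interior points;
the endpoints are a null set. -/
lemma ae_mem_Ioo_of_mem_Icc : ∀ᵐ x : ℝ, x ∈ Icc (0 : ℝ) 1 → x ∈ Ioo (0 : ℝ) 1 := by
  have h₁ : ∀ᵐ x : ℝ, x ≠ 0 := by simp [ae_iff, measure_singleton]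
  have h₂ : ∀ᵐ x : ℝ, x ≠ 1 := by simp [ae_iff, measure_singleton]
  filter_upwards [h₁, h₂] with x h₁ h₂ hx
  exact ⟨lt_of_le_of_ne hx.1 (Ne.symm h₁), lt_of_le_of_ne hx.2 h₂⟩

lemma absolutelyContinuousOnInterval_congr {E : Type*} [PseudoMetricSpace E] {f g : ℝ → E}
    {a b : ℝ} (hf : AbsolutelyContinuousOnInterval f a b) (h : EqOn f g (uIcc a b)) :
    AbsolutelyContinuousOnInterval g a b := by
  rw [absolutelyContinuousOnInterval_iff] at hf ⊢
  intro ε hε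
  obtain ⟨δ, hδ, H⟩ := hf ε hε
  refine ⟨δ, hδ, fun E hE hd => ?_⟩
  refine lt_of_eq_of_lt (Finset.sum_congr rfl fun i hi => ?_) (H E hE hd)
  rw [h (hE.1 i hi).1, h (hE.1 i hi).2]

lemma absolutelyContinuousOnInterval_of_dist_le {E F : Type*} [PseudoMetricSpace E]
    [PseudoMetricSpace F] {f : ℝ → E} {g : ℝ → F}
    {a b : ℝ} (hf : AbsolutelyContinuousOnInterval f a b)
    (h : ∀ x y, dist (g x) (g y) ≤ dist (f x) (f y)) :
    AbsolutelyContinuousOnInterval g a b := by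
  rw [absolutelyContinuousOnInterval_iff] at hf ⊢
  intro ε hε
  obtain ⟨δ, hδ, H⟩ := hf ε hε
  exact ⟨δ, hδ, fun E hE hd => lt_of_le_of_lt (Finset.sum_le_sum fun i _ => h _ _) (H E hE hd)⟩

namespace HasACDeriv

variable {f f' g g' : ℝ → ℂ}

lemma continuousOn (hf : HasACDeriv f f') : ContinuousOn f (Icc 0 1) :=
  uIcc_zero_one ▸ hf.ac.continuousOn

lemma congr (hf : HasACDeriv f f') (h : EqOn f g (Icc 0 1)) (h' : EqOn f' g' (Icc 0 1)) :
    HasACDeriv g g' where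
  ac := absolutelyContinuousOnInterval_congr hf.ac (uIcc_zero_one ▸ h)
  int := hf.int.congr (by
    intro x hx
    exact h' (Ioc_subset_Icc_self (by rwa [uIoc_of_le zero_le_one] at hx)))
  deriv := by
    filter_upwards [hf.deriv, ae_mem_Ioo_of_mem_Icc] with x hx hx' hxm
    rw [← h' hxm]
    refine (hx hxm).congr_of_eventuallyEq ?_
    filter_upwards [Icc_mem_nhds (hx' hxm).1 (hx' hxm).2] with y hy using (h hy).symm

lemma add (hf : HasACDeriv f f') (hg : HasACDeriv g g') :
    HasACDeriv (fun x => f x + g x) (fun x => f' x + g' x) where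
  ac := hf.ac.add hg.ac
  int := hf.int.add hg.int
  deriv := by
    filter_upwards [hf.deriv, hg.deriv] with x h₁ h₂ hx using (h₁ hx).add (h₂ hx)

lemma mul (hf : HasACDeriv f f') (hg : HasACDeriv g g') :
    HasACDeriv (fun x => f x * g x) (fun x => f' x * g x + f x * g' x) where
  ac := hf.ac.smul hg.ac
  int := (hf.int.mul_continuousOn hg.ac.continuousOn).add
    (hg.int.continuousOn_mul hf.ac.continuousOn)
  deriv := by
    filter_upwards [hf.deriv, hg.deriv] with x h₁ h₂ hx using (h₁ hx).mul (h₂ hx)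

lemma of_contDiff (hf : ContDiff ℝ 1 f) : HasACDeriv f (_root_.deriv f) where
  ac := hf.contDiffOn.absolutelyContinuousOnInterval
  int := (hf.continuous_deriv le_rfl).intervalIntegrable _ _
  deriv := .of_forall fun x _ => (hf.differentiable one_ne_zero x).hasDerivAt

lemma const (c : ℂ) : HasACDeriv (fun _ => c) (fun _ => 0) := by
  simpa using of_contDiff (f := fun _ => c) contDiff_const

lemma const_mul (c : ℂ) (hf : HasACDeriv f f') : HasACDeriv (fun x => c * f x)
    (fun x => c * f' x) :=
  ((const c).mul hf).congr (fun _ _ => rfl) (fun x _ => by simp)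

lemma neg (hf : HasACDeriv f f') : HasACDeriv (fun x => -f x) (fun x => -f' x) :=
  (hf.const_mul (-1)).congr (fun _ _ => by simp) (fun x _ => by simp)

lemma sub (hf : HasACDeriv f f') (hg : HasACDeriv g g') :
    HasACDeriv (fun x => f x - g x) (fun x => f' x - g' x) :=
  (hf.add hg.neg).congr (fun _ _ => by simp [sub_eq_add_neg]) (fun x _ => by simp [sub_eq_add_neg])

lemma exp (a b : ℂ) : HasACDeriv (fun x => Complex.exp (a * x + b))
    (fun x => a * Complex.exp (a * x + b)) := by
  have h : ∀ x : ℝ, HasDerivAt (fun x : ℝ => Complex.exp (a * x + b))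
      (a * Complex.exp (a * x + b)) x := fun x => by
    have h₁ : HasDerivAt (fun z : ℂ => a * z + b) (a * 1) x :=
      ((hasDerivAt_id (x : ℂ)).const_mul a).add_const b
    have := (h₁.cexp).comp_ofReal
    simpa [mul_comm] using this
  refine (of_contDiff ?_).congr (fun _ _ => rfl) (fun x _ => (h x).deriv)
  have : ContDiff ℝ 1 (fun x : ℝ => (x : ℂ)) := Complex.ofRealCLM.contDiff
  fun_prop

lemma primitive (h : IntervalIntegrable f' volume 0 1) {c : ℝ} (hc : c ∈ Icc (0 : ℝ) 1) :
    HasACDeriv (fun x => ∫ t in c..x, f' t) f' where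
  ac := by
    have hc' : c ∈ uIcc (0 : ℝ) 1 := uIcc_zero_one ▸ hc
    -- Real and imaginary parts are primitives of real functions; they are recombined as `re • 1 +
    -- im • I`.
    have hre : IntervalIntegrable (fun x => (f' x).re) volume 0 1 := ⟨h.1.re, h.2.re⟩
    have him : IntervalIntegrable (fun x => (f' x).im) volume 0 1 := ⟨h.1.im, h.2.im⟩
    have cst : ∀ z : ℂ, AbsolutelyContinuousOnInterval (fun _ : ℝ => z) 0 1 :=
      fun z => (const z).ac
    have key := ((hre.absolutelyContinuousOnInterval_intervalIntegral hc').smul (cst 1)).add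
      ((him.absolutelyContinuousOnInterval_intervalIntegral hc').smul (cst Complex.I))
    refine absolutelyContinuousOnInterval_congr key fun x hx => ?_
    have hi : IntervalIntegrable f' volume c x := h.mono_set (uIcc_subset_uIcc hc' hx)
    have e1 : ∫ t in c..x, (f' t).re = (∫ t in c..x, f' t).re :=
      Complex.reCLM.intervalIntegral_comp_comm hi
    have e2 : ∫ t in c..x, (f' t).im = (∫ t in c..x, f' t).im :=
      Complex.imCLM.intervalIntegral_comp_comm hi
    simp only [Pi.add_apply, Pi.smul_apply', e1, e2]
    apply Complex.ext <;> simp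
  int := h
  deriv := by
    filter_upwards [h.ae_hasDerivAt_integral] with x hx hxm
    exact hx (uIcc_zero_one ▸ hxm) c (uIcc_zero_one ▸ hc)

lemma eq_of_deriv_eq_zero (hf : HasACDeriv f f') (h : EqOn f' 0 (Icc 0 1)) {a b : ℝ}
    (ha : a ∈ Icc (0 : ℝ) 1) (hb : b ∈ Icc (0 : ℝ) 1) : f a = f b := by
  obtain ⟨C, hC⟩ := hf.ac.const_of_ae_hasDerivAt_zero (by
    filter_upwards [hf.deriv] with x hx hxm
    rw [uIcc_zero_one] at hxm
    simpa [h hxm] using hx hxm)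
  rw [uIcc_zero_one] at hC
  rw [hC a ha, hC b hb]

lemma integral_eq_sub (hf : HasACDeriv f f') {a b : ℝ}
    (ha : a ∈ Icc (0 : ℝ) 1) (hb : b ∈ Icc (0 : ℝ) 1) : ∫ t in a..b, f' t = f b - f a := by
  have := (hf.sub (primitive hf.int ha)).eq_of_deriv_eq_zero (fun x _ => by simp) hb ha
  simp only [intervalIntegral.integral_same, sub_zero] at this
  rw [← this]; ring

lemma primitive_right (h : IntervalIntegrable f' volume 0 1) :
    HasACDeriv (fun x => ∫ t in x..1, f' t) (fun x => -f' x) :=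
  (primitive h (c := 1) (by simp)).neg.congr
    (fun x _ => by simp only; rw [intervalIntegral.integral_symm, neg_neg]) (fun _ _ => rfl)

/-- By the fundamental theorem `f (1 - x) = f 1 - ∫₀ˣ f' (1 - t) dt`, so the reflected function is
again a primitive. -/
lemma reflect (hf : HasACDeriv f f') :
    HasACDeriv (fun x => f (1 - x)) (fun x => -f' (1 - x)) := by
  have hi : IntervalIntegrable (fun x => f' (1 - x)) volume 0 1 := by
    simpa using (hf.int.comp_sub_left 1).symm
  have h1 := ((const (f 1)).sub (primitive hi (c := 0) (by simp)))
  refine h1.congr (fun x hx => ?_) (fun x _ => by simp)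
  have := hf.integral_eq_sub (a := 1 - x) (b := 1) ⟨by linarith [hx.2], by linarith [hx.1]⟩
    (by simp)
  simp only [intervalIntegral.integral_comp_sub_left (fun t => f' t), sub_zero, this]
  ring

end HasACDeriv

/-! ### Integral bounds and the contraction principle -/

lemma norm_integral_le_of_norm_le_mul {f : ℝ → ℂ} {g : ℝ → ℝ} {a b c : ℝ} (hab : a ≤ b)
    (ha : a ∈ Icc (0 : ℝ) 1) (hb : b ∈ Icc (0 : ℝ) 1) (hc : 0 ≤ c)
    (hg : IntervalIntegrable g volume 0 1) (hg0 : ∀ t, 0 ≤ g t)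
    (h : ∀ t ∈ Icc a b, ‖f t‖ ≤ c * g t) :
    ‖∫ t in a..b, f t‖ ≤ c * ∫ t in (0 : ℝ)..1, g t := by
  have hab' : IntervalIntegrable g volume a b :=
    hg.mono_set (uIcc_subset_uIcc (uIcc_zero_one ▸ ha) (uIcc_zero_one ▸ hb))
  calc ‖∫ t in a..b, f t‖ ≤ ∫ t in a..b, c * g t :=
        intervalIntegral.norm_integral_le_of_norm_le hab
          (.of_forall fun t ht => h t (Ioc_subset_Icc_self ht)) (hab'.const_mul c)
    _ = c * ∫ t in a..b, g t := by rw [intervalIntegral.integral_const_mul]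
    _ ≤ c * ∫ t in (0 : ℝ)..1, g t := by
        gcongr
        exact intervalIntegral.integral_mono_interval ha.1 hab hb.2
          (.of_forall fun t => hg0 t) hg

/-- Banach's fixed point theorem for maps of continuous functions on `[0,1]`, with the a priori
estimate of the distance to the fixed point. -/
lemma exists_fixedPoint_of_contracting {E : Type*} [NormedAddCommGroup E] [CompleteSpace E]
    (Φ : (ℝ → E) → ℝ → E)
    (hΦ : ∀ z, ContinuousOn z (Icc 0 1) → ContinuousOn (Φ z) (Icc 0 1))
    (hc : ∀ z w, ContinuousOn z (Icc 0 1) → ContinuousOn w (Icc 0 1) →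
      ∀ b, (∀ x ∈ Icc (0 : ℝ) 1, ‖z x - w x‖ ≤ b) → ∀ x ∈ Icc (0 : ℝ) 1, ‖Φ z x - Φ w x‖ ≤ b / 2) :
    ∃ z, ContinuousOn z (Icc 0 1) ∧ (∀ x ∈ Icc (0 : ℝ) 1, z x = Φ z x) ∧
      ∀ w, ContinuousOn w (Icc 0 1) → ∀ b, 0 ≤ b → (∀ x ∈ Icc (0 : ℝ) 1, ‖w x - Φ w x‖ ≤ b) →
        ∀ x ∈ Icc (0 : ℝ) 1, ‖z x - w x‖ ≤ 2 * b := by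
  have h01 : (0 : ℝ) ≤ 1 := zero_le_one
  let ext : C(Icc (0 : ℝ) 1, E) → ℝ → E := fun u => IccExtend h01 u
  have hext : ∀ u, ContinuousOn (ext u) (Icc 0 1) :=
    fun u => u.continuous.Icc_extend'.continuousOn
  have hexta : ∀ u (x : Icc (0 : ℝ) 1), ext u x = u x := fun u x => by
    simp [ext]
  let T : C(Icc (0 : ℝ) 1, E) → C(Icc (0 : ℝ) 1, E) := fun u =>
    ⟨(Icc (0 : ℝ) 1).domRestrict (Φ (ext u)),
      continuousOn_iff_continuous_domRestrict.1 (hΦ _ (hext u))⟩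
  have hT : ContractingWith (1 / 2) T := by
    refine ⟨by norm_num, LipschitzWith.of_dist_le_mul fun u v => ?_⟩
    rw [ContinuousMap.dist_le (by positivity)]
    intro x
    rw [dist_eq_norm]
    have := hc (ext u) (ext v) (hext u) (hext v) (dist u v) (fun y hy => by
      rw [hexta u ⟨y, hy⟩, hexta v ⟨y, hy⟩, ← dist_eq_norm]
      exact ContinuousMap.dist_apply_le_dist _) x x.2
    refine this.trans (le_of_eq ?_)
    push_cast; ring
  refine ⟨ext (hT.fixedPoint T), hext _, fun x hx => ?_, fun w hw b hb h x hx => ?_⟩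
  · have : T (hT.fixedPoint T) ⟨x, hx⟩ = hT.fixedPoint T ⟨x, hx⟩ :=
      congrArg (fun u : C(Icc (0 : ℝ) 1, E) => u ⟨x, hx⟩) hT.fixedPoint_isFixedPt
    rw [hexta _ ⟨x, hx⟩, ← this]
    rfl
  · let u : C(Icc (0 : ℝ) 1, E) := ⟨(Icc (0 : ℝ) 1).domRestrict w,
      continuousOn_iff_continuous_domRestrict.1 hw⟩
    have hu : ∀ y ∈ Icc (0 : ℝ) 1, ext u y = w y := fun y hy => hexta u ⟨y, hy⟩
    -- The contraction hypothesis with bound `0` shows that `Φ` on `[0,1]` sees only the values of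
    -- its argument on `[0,1]`.
    have h1 : ∀ y ∈ Icc (0 : ℝ) 1, Φ (ext u) y = Φ w y := fun y hy => by
      have := hc (ext u) w (hext u) hw 0 (fun y hy => by rw [hu y hy]; simp) y hy
      simpa [sub_eq_zero] using this
    have h2 := hT.dist_fixedPoint_le u
    have h3 : dist u (T u) ≤ b := by
      rw [ContinuousMap.dist_le hb]
      intro y
      rw [dist_eq_norm]
      have : T u y = Φ w y := h1 y y.2
      rw [this]
      exact h y y.2
    have h4 : dist (hT.fixedPoint T) u ≤ 2 * b := by
      rw [dist_comm]
      refine h2.trans ?_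
      rw [div_le_iff₀ (by norm_num)]
      norm_num
      linarith
    rw [hexta _ ⟨x, hx⟩, ← dist_eq_norm]
    exact (ContinuousMap.dist_apply_le_dist (f := hT.fixedPoint T) (g := u) ⟨x, hx⟩).trans h4

/-! ### Oscillatory integrals with kernel `e^{2iμ(s-x)}` -/

lemma norm_exp_two_I_mul (μ : ℂ) (y : ℝ) :
    ‖Complex.exp (2 * Complex.I * μ * y)‖ = Real.exp (-(2 * μ.im * y)) := by
  rw [Complex.norm_exp]
  congr 1
  simp

lemma norm_exp_two_I_mul_le {μ : ℂ} {r y : ℝ} (hr : 0 ≤ r) (hμ : -r < μ.im) (hy : 0 ≤ y)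
    (hy1 : y ≤ 1) : ‖Complex.exp (2 * Complex.I * μ * y)‖ ≤ Real.exp (2 * r) := by
  rw [norm_exp_two_I_mul]
  gcongr
  nlinarith

lemma continuous_exp_kernel (μ : ℂ) (x : ℝ) :
    Continuous fun s : ℝ => Complex.exp (2 * Complex.I * μ * ((s - x : ℝ) : ℂ)) := by
  fun_prop

lemma hasACDeriv_exp_kernel (μ : ℂ) (x : ℝ) :
    HasACDeriv (fun s : ℝ => Complex.exp (2 * Complex.I * μ * ((s - x : ℝ) : ℂ)))
      (fun s : ℝ => 2 * Complex.I * μ * Complex.exp (2 * Complex.I * μ * ((s - x : ℝ) : ℂ))) := by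
  refine (HasACDeriv.exp (2 * Complex.I * μ) (-(2 * Complex.I * μ * x))).congr
    (fun s _ => ?_) (fun s _ => ?_) <;>
  · simp only; push_cast; ring_nf

/-- Integration by parts gains the factor `|μ|⁻¹`: the boundary terms and the integral of `g'` are
bounded uniformly because the kernel is at most `e^{2r}` for `s ≥ x`. This is the smooth case of the
Riemann–Lebesgue estimate. -/
lemma norm_integral_exp_kernel_mul_contDiff_le {g : ℝ → ℂ} (hg : ContDiff ℝ 1 g) {r : ℝ}
    (hr : 0 ≤ r) : ∃ C : ℝ, 0 ≤ C ∧ ∀ μ : ℂ, -r < μ.im → ∀ x ∈ Icc (0 : ℝ) 1, ∀ t ∈ Icc x 1,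
      ‖μ‖ * ‖∫ s in t..1, Complex.exp (2 * Complex.I * μ * ((s - x : ℝ) : ℂ)) * g s‖ ≤ C := by
  obtain ⟨M, hM⟩ := isCompact_Icc.exists_bound_of_continuousOn
    (s := Icc (0 : ℝ) 1) hg.continuous.continuousOn
  obtain ⟨M', hM'⟩ := isCompact_Icc.exists_bound_of_continuousOn
    (s := Icc (0 : ℝ) 1) (hg.continuous_deriv le_rfl).continuousOn
  have hM0 : 0 ≤ M := (norm_nonneg _).trans (hM 0 (by simp))
  have hM0' : 0 ≤ M' := (norm_nonneg _).trans (hM' 0 (by simp))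
  refine ⟨Real.exp (2 * r) * (2 * M + M'), by positivity, fun μ hμ x hx t ht => ?_⟩
  set e : ℝ → ℂ := fun s => Complex.exp (2 * Complex.I * μ * ((s - x : ℝ) : ℂ)) with he
  have hec : Continuous e := continuous_exp_kernel μ x
  have hb : ∀ s ∈ Icc t 1, ‖e s‖ ≤ Real.exp (2 * r) := fun s hs =>
    norm_exp_two_I_mul_le hr hμ (by linarith [hs.1, ht.1]) (by linarith [hs.2, hx.1])
  have ht0 : t ∈ Icc (0 : ℝ) 1 := ⟨hx.1.trans ht.1, ht.2⟩
  have h1 := ((hasACDeriv_exp_kernel μ x).mul (HasACDeriv.of_contDiff hg)).integral_eq_sub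
    ht0 (b := 1) (by simp)
  have h2 : ∫ s in t..1, 2 * Complex.I * μ * e s * g s + e s * deriv g s =
      2 * Complex.I * μ * (∫ s in t..1, e s * g s) + ∫ s in t..1, e s * deriv g s := by
    rw [← intervalIntegral.integral_const_mul, ← intervalIntegral.integral_add]
    · congr 1; ext s; ring
    · exact (continuous_const.mul (hec.mul hg.continuous)).intervalIntegrable _ _
    · exact (hec.mul (hg.continuous_deriv le_rfl)).intervalIntegrable _ _
  have h3 : 2 * Complex.I * μ * (∫ s in t..1, e s * g s) =
      e 1 * g 1 - e t * g t - ∫ s in t..1, e s * deriv g s := by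
    rw [eq_sub_iff_add_eq, ← h2]; exact h1
  have h4 : ‖∫ s in t..1, e s * deriv g s‖ ≤ Real.exp (2 * r) * M' := by
    have := norm_integral_le_of_norm_le_mul (f := fun s => e s * deriv g s) (g := fun _ => 1)
      ht.2 ht0 (by simp) (c := Real.exp (2 * r) * M') (by positivity) (by simp) (by simp)
      (fun s hs => by
        rw [norm_mul, mul_one]
        exact mul_le_mul (hb s hs) (hM' s ⟨ht0.1.trans hs.1, hs.2⟩) (norm_nonneg _)
          (by positivity))
    simpa using this
  have h5 : ∀ s ∈ Icc t 1, ‖e s * g s‖ ≤ Real.exp (2 * r) * M := fun s hs => by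
    rw [norm_mul]
    exact mul_le_mul (hb s hs) (hM s ⟨ht0.1.trans hs.1, hs.2⟩) (norm_nonneg _) (by positivity)
  have h6 : ‖2 * Complex.I * μ * (∫ s in t..1, e s * g s)‖ =
      2 * (‖μ‖ * ‖∫ s in t..1, e s * g s‖) := by simp [mul_assoc]
  have h7 : ‖e 1 * g 1 - e t * g t - ∫ s in t..1, e s * deriv g s‖ ≤
      Real.exp (2 * r) * (2 * M + M') := by
    calc _ ≤ ‖e 1 * g 1‖ + ‖e t * g t‖ + ‖∫ s in t..1, e s * deriv g s‖ :=
          (norm_sub_le _ _).trans (by gcongr; exact norm_sub_le _ _)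
      _ ≤ Real.exp (2 * r) * M + Real.exp (2 * r) * M + Real.exp (2 * r) * M' :=
          add_le_add (add_le_add (h5 1 ⟨ht.2, le_rfl⟩) (h5 t ⟨le_rfl, ht.2⟩)) h4
      _ = _ := by ring
  rw [← h3, h6] at h7
  have : 0 ≤ ‖μ‖ * ‖∫ s in t..1, e s * g s‖ := by positivity
  linarith

/-- The Riemann–Lebesgue lemma, uniformly in a half-plane and in the interval of integration. -/
lemma exists_norm_integral_exp_kernel_mul_le {σ : ℝ → ℂ} (hσ : IntervalIntegrable σ volume 0 1)
    {r ε : ℝ} (hr : 0 ≤ r) (hε : 0 < ε) :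
    ∃ R : ℝ, 0 < R ∧ ∀ μ : ℂ, -r < μ.im → R < ‖μ‖ → ∀ x ∈ Icc (0 : ℝ) 1, ∀ t ∈ Icc x 1,
      ‖∫ s in t..1, Complex.exp (2 * Complex.I * μ * ((s - x : ℝ) : ℂ)) * σ s‖ ≤ ε := by
  -- The `L¹` error of a smooth approximation is amplified by at most `e^{2r}`, so this `δ` leaves
  -- `ε / 2` for the smooth part.
  set δ : ℝ := ε / 2 / Real.exp (2 * r) with hδ
  have hδ0 : 0 < δ := by positivity
  have hm : MemLp σ 1 (volume.restrict (Ioc (0 : ℝ) 1)) := memLp_one_iff_integrable.2 hσ.1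
  obtain ⟨g, -, hg, hgσ⟩ := hm.exist_eLpNorm_sub_le (by simp) le_rfl hδ0
  have hg1 : ContDiff ℝ 1 g := hg.of_le (by exact_mod_cast le_top)
  have hgi : IntervalIntegrable g volume 0 1 := hg1.continuous.intervalIntegrable _ _
  have hN : ∫ t in (0 : ℝ)..1, ‖σ t - g t‖ ≤ δ := by
    rw [intervalIntegral.integral_of_le zero_le_one,
      integral_norm_eq_lintegral_enorm (hσ.sub hgi).1.aestronglyMeasurable]
    rw [eLpNorm_one_eq_lintegral_enorm] at hgσ
    exact ENNReal.toReal_le_of_le_ofReal hδ0.le hgσ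
  obtain ⟨C, hC0, hC⟩ := norm_integral_exp_kernel_mul_contDiff_le hg1 hr
  refine ⟨2 * C / ε + 1, by positivity, fun μ hμ hR x hx t ht => ?_⟩
  have ht0 : t ∈ Icc (0 : ℝ) 1 := ⟨hx.1.trans ht.1, ht.2⟩
  set e : ℝ → ℂ := fun s => Complex.exp (2 * Complex.I * μ * ((s - x : ℝ) : ℂ)) with he
  have hec : Continuous e := continuous_exp_kernel μ x
  have hsub : ∀ f : ℝ → ℂ, IntervalIntegrable f volume 0 1 → IntervalIntegrable f volume t 1 :=
    fun f hf => hf.mono_set (uIcc_subset_uIcc (uIcc_zero_one ▸ ht0) (by simp))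
  have h1 : ∫ s in t..1, e s * σ s =
      (∫ s in t..1, e s * (σ s - g s)) + ∫ s in t..1, e s * g s := by
    rw [← intervalIntegral.integral_add]
    · congr 1; ext s; ring
    · exact ((hsub _ hσ).sub (hsub _ hgi)).continuousOn_mul hec.continuousOn
    · exact (hsub _ hgi).continuousOn_mul hec.continuousOn
  have h2 : ‖∫ s in t..1, e s * (σ s - g s)‖ ≤ ε / 2 := by
    have := norm_integral_le_of_norm_le_mul (f := fun s => e s * (σ s - g s))
      (g := fun s => ‖σ s - g s‖)
      ht.2 ht0 (by simp) (c := Real.exp (2 * r)) (by positivity) (hσ.sub hgi).norm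
      (fun _ => norm_nonneg _)
      (fun s hs => by
        rw [norm_mul]
        gcongr
        exact norm_exp_two_I_mul_le hr hμ (by linarith [hs.1, ht.1]) (by linarith [hs.2, hx.1]))
    refine this.trans ?_
    calc _ ≤ Real.exp (2 * r) * δ := by gcongr
      _ = ε / 2 := by rw [hδ]; field_simp
  have h3 : ‖∫ s in t..1, e s * g s‖ ≤ ε / 2 := by
    have h4 := hC μ hμ x hx t ht
    have hμ0 : 0 < ‖μ‖ := lt_trans (by positivity) hR
    have h5 : 2 * C / ε < ‖μ‖ := by linarith
    rw [div_lt_iff₀ hε] at h5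
    have h6 : ‖μ‖ * ‖∫ s in t..1, e s * g s‖ ≤ ‖μ‖ * (ε / 2) := h4.trans (by linarith)
    exact le_of_mul_le_mul_left h6 hμ0
  change ‖∫ s in t..1, e s * σ s‖ ≤ ε
  rw [h1]
  exact (norm_add_le _ _).trans (by linarith)

/-- The kernel factors as `e^{-2iμx} e^{2iμs}`, so the product rule applies; the result is the
equation for `u₂` with source `f`. -/
lemma hasACDeriv_integral_exp_kernel {f : ℝ → ℂ} (hf : IntervalIntegrable f volume 0 1) (μ : ℂ) :
    HasACDeriv
      (fun x => ∫ s in x..1, Complex.exp (2 * Complex.I * μ * ((s - x : ℝ) : ℂ)) * f s)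
      (fun x => -(2 * Complex.I * μ *
        ∫ s in x..1, Complex.exp (2 * Complex.I * μ * ((s - x : ℝ) : ℂ)) * f s) - f x) := by
  have hi : IntervalIntegrable
      (fun s => Complex.exp (2 * Complex.I * μ * ((s - 0 : ℝ) : ℂ)) * f s) volume 0 1 :=
    hf.continuousOn_mul (continuous_exp_kernel μ 0).continuousOn
  have key : ∀ x : ℝ, Complex.exp (-(2 * Complex.I * μ) * x + 0) *
      ∫ s in x..1, Complex.exp (2 * Complex.I * μ * ((s - 0 : ℝ) : ℂ)) * f s =
      ∫ s in x..1, Complex.exp (2 * Complex.I * μ * ((s - x : ℝ) : ℂ)) * f s := fun x => by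
    rw [← intervalIntegral.integral_const_mul]
    congr 1; ext s
    rw [← mul_assoc, ← Complex.exp_add]
    congr 2
    push_cast; ring
  refine ((HasACDeriv.exp (-(2 * Complex.I * μ)) 0).mul (HasACDeriv.primitive_right hi)).congr
    (fun x _ => key x) (fun x _ => ?_)
  simp only
  rw [mul_assoc, key x]
  have : Complex.exp (-(2 * Complex.I * μ) * x + 0) *
      Complex.exp (2 * Complex.I * μ * ((x - 0 : ℝ) : ℂ)) = 1 := by
    rw [← Complex.exp_add, Complex.exp_eq_one_iff]
    exact ⟨0, by push_cast; ring⟩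
  linear_combination (-f x) * this

/-- With `H t = ∫ₜ¹ e σ`, integration by parts gives `∫ₓ¹ e σ k = H x * k x + ∫ₓ¹ H k'`. Smallness
of the tails `H` thus survives multiplication by an absolutely continuous factor. -/
lemma norm_integral_exp_kernel_mul_mul_le {σ k k' : ℝ → ℂ} (hσ : IntervalIntegrable σ volume 0 1)
    (hk : HasACDeriv k k') {μ : ℂ} {ε x : ℝ} (hε : 0 ≤ ε) (hx : x ∈ Icc (0 : ℝ) 1)
    (h : ∀ t ∈ Icc x 1,
      ‖∫ s in t..1, Complex.exp (2 * Complex.I * μ * ((s - x : ℝ) : ℂ)) * σ s‖ ≤ ε) :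
    ‖∫ s in x..1, Complex.exp (2 * Complex.I * μ * ((s - x : ℝ) : ℂ)) * (σ s * k s)‖ ≤
      ε * (‖k x‖ + ∫ t in (0 : ℝ)..1, ‖k' t‖) := by
  set e : ℝ → ℂ := fun s => Complex.exp (2 * Complex.I * μ * ((s - x : ℝ) : ℂ)) with he
  have hi : IntervalIntegrable (fun s => e s * σ s) volume 0 1 :=
    hσ.continuousOn_mul (continuous_exp_kernel μ x).continuousOn
  have hH := HasACDeriv.primitive_right hi
  set H : ℝ → ℂ := fun t => ∫ s in t..1, e s * σ s with hHdef
  have h1 := (hH.mul hk).integral_eq_sub hx (b := 1) (by simp)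
  have hsub : ∀ f : ℝ → ℂ, IntervalIntegrable f volume 0 1 → IntervalIntegrable f volume x 1 :=
    fun f hf => hf.mono_set (uIcc_subset_uIcc (uIcc_zero_one ▸ hx) (by simp))
  have hcH : ContinuousOn H (uIcc 0 1) := uIcc_zero_one ▸ hH.continuousOn
  have hck : ContinuousOn k (uIcc 0 1) := uIcc_zero_one ▸ hk.continuousOn
  rw [intervalIntegral.integral_add (hsub _ (hH.int.mul_continuousOn hck))
    (hsub _ (hk.int.continuousOn_mul hcH))] at h1
  have h2 : ∫ s in x..1, e s * (σ s * k s) = H x * k x + ∫ s in x..1, H s * k' s := by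
    have h3 : ∫ s in x..1, -(e s * σ s) * k s = -∫ s in x..1, e s * (σ s * k s) := by
      rw [← intervalIntegral.integral_neg]
      congr 1; ext s; ring
    have h4 : H 1 = 0 := by simp [hHdef]
    rw [h3, h4] at h1
    linear_combination -h1
  have h5 : ‖∫ s in x..1, H s * k' s‖ ≤ ε * ∫ t in (0 : ℝ)..1, ‖k' t‖ :=
    norm_integral_le_of_norm_le_mul hx.2 hx (by simp) hε hk.int.norm (fun _ => norm_nonneg _)
      (fun s hs => by
        rw [norm_mul]
        gcongr
        exact h s hs)
  rw [h2]
  calc _ ≤ ‖H x‖ * ‖k x‖ + ε * ∫ t in (0 : ℝ)..1, ‖k' t‖ := by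
        refine (norm_add_le _ _).trans ?_
        rw [norm_mul]
        gcongr
    _ ≤ ε * ‖k x‖ + ε * ∫ t in (0 : ℝ)..1, ‖k' t‖ := by
        gcongr
        exact h x ⟨le_rfl, hx.2⟩
    _ = _ := by ring

/-! ### The amplitudes `u₁, u₂` of `W = e^{iμx}(u₁, u₂)` -/

lemma exists_normalized_solution {σ₁ σ₂ : ℝ → ℂ} (hσ₁ : IntervalIntegrable σ₁ volume 0 1)
    (hσ₂ : IntervalIntegrable σ₂ volume 0 1) {r : ℝ} (hr : 0 ≤ r) :
    ∃ R : ℝ, 0 < R ∧ ∀ μ : ℂ, -r < μ.im → R < ‖μ‖ → ∃ u₁ u₂ : ℝ → ℂ,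
      HasACDeriv u₁ (fun x => -(σ₁ x * u₂ x)) ∧
      HasACDeriv u₂ (fun x => -(2 * Complex.I * μ * u₂ x) - σ₂ x * u₁ x) ∧
      u₁ 0 = 1 ∧ u₂ 1 = 0 ∧
      ∀ x ∈ Icc (0 : ℝ) 1, ‖u₁ x - 1‖ ≤ 1 / 2 ∧ ‖u₂ x‖ ≤ 1 / 2 := by
  set N : ℝ := ∫ t in (0 : ℝ)..1, ‖σ₁ t‖ with hN
  have hN0 : 0 ≤ N := intervalIntegral.integral_nonneg zero_le_one fun _ _ => norm_nonneg _
  -- `ε * N ≤ 1/4` gives contraction factor `2εN ≤ 1/2` and `‖u₁ - 1‖ ≤ 2εN ≤ 1/2`; `ε ≤ 1/4` gives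
  -- `‖u₂‖ ≤ 2ε ≤ 1/2`.
  set ε : ℝ := 1 / (4 * (N + 1)) with hε
  have hε0 : 0 < ε := by positivity
  have hεN : ε * N ≤ 1 / 4 := by
    rw [hε, div_mul_eq_mul_div, div_le_iff₀ (by positivity)]; linarith
  have hε4 : ε ≤ 1 / 4 := by
    rw [hε, div_le_iff₀ (by positivity)]; linarith
  obtain ⟨R, hR, H⟩ := exists_norm_integral_exp_kernel_mul_le hσ₂ hr hε0
  refine ⟨R, hR, fun μ hμ hμR => ?_⟩
  have H := H μ hμ hμR
  -- `m u` is the first amplitude determined by the second, `u`; eliminating it leaves the scalar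
  -- equation `u = Φ u`.
  let m : (ℝ → ℂ) → ℝ → ℂ := fun u t => 1 - ∫ s in (0 : ℝ)..t, σ₁ s * u s
  let Φ : (ℝ → ℂ) → ℝ → ℂ := fun u x =>
    ∫ s in x..1, Complex.exp (2 * Complex.I * μ * ((s - x : ℝ) : ℂ)) * (σ₂ s * m u s)
  have hiu : ∀ u, ContinuousOn u (Icc 0 1) → IntervalIntegrable (fun s => σ₁ s * u s) volume 0 1 :=
    fun u hu => hσ₁.mul_continuousOn (uIcc_zero_one ▸ hu)
  have hm : ∀ u, ContinuousOn u (Icc 0 1) → HasACDeriv (m u) (fun x => -(σ₁ x * u x)) := fun u hu =>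
    ((HasACDeriv.const 1).sub (HasACDeriv.primitive (hiu u hu) (c := 0) (by simp))).congr
      (fun x _ => rfl) (fun x _ => by simp)
  have him : ∀ u, ContinuousOn u (Icc 0 1) → IntervalIntegrable (fun s => σ₂ s * m u s) volume 0 1 :=
    fun u hu => hσ₂.mul_continuousOn (hm u hu).ac.continuousOn
  have hΦ : ∀ u, ContinuousOn u (Icc 0 1) → HasACDeriv (Φ u)
      (fun x => -(2 * Complex.I * μ * Φ u x) - σ₂ x * m u x) := fun u hu =>
    hasACDeriv_integral_exp_kernel (him u hu) μ
  have hint : ∀ u, ContinuousOn u (Icc 0 1) → ∀ b, 0 ≤ b → (∀ x ∈ Icc (0 : ℝ) 1, ‖u x‖ ≤ b) →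
      ∀ x ∈ Icc (0 : ℝ) 1, ‖∫ s in (0 : ℝ)..x, σ₁ s * u s‖ ≤ b * N := fun u hu b hb h x hx =>
    norm_integral_le_of_norm_le_mul hx.1 (by simp) hx hb hσ₁.norm (fun _ => norm_nonneg _)
      (fun s hs => by
        rw [norm_mul, mul_comm]
        gcongr
        exact h s ⟨hs.1, hs.2.trans hx.2⟩)
  obtain ⟨u, hu, hfix, hapr⟩ := exists_fixedPoint_of_contracting Φ
    (fun u hu => (hΦ u hu).continuousOn) (fun u w hu hw b hb x hx => by
      have hb0 : 0 ≤ b := (norm_nonneg _).trans (hb 0 (by simp))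
      have hd := hu.sub hw
      have hk := (HasACDeriv.primitive (hiu _ hd) (c := 0) (by simp)).neg
      -- The difference `m u - m w` is absolutely continuous with derivative `-σ₁(u - w)`, so the
      -- oscillatory estimate applies to it without any pointwise smallness of the kernel.
      have h1 : Φ u x - Φ w x = ∫ s in x..1,
          Complex.exp (2 * Complex.I * μ * ((s - x : ℝ) : ℂ)) *
            (σ₂ s * -∫ t in (0 : ℝ)..s, σ₁ t * (u - w) t) := by
        have hsub : ∀ f : ℝ → ℂ, IntervalIntegrable f volume 0 1 →
            IntervalIntegrable f volume x 1 :=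
          fun f hf => hf.mono_set (uIcc_subset_uIcc (uIcc_zero_one ▸ hx) (by simp))
        simp only [Φ]
        rw [← intervalIntegral.integral_sub
          ((hsub _ (him u hu)).continuousOn_mul (continuous_exp_kernel μ x).continuousOn)
          ((hsub _ (him w hw)).continuousOn_mul (continuous_exp_kernel μ x).continuousOn)]
        refine intervalIntegral.integral_congr fun s hs => ?_
        rw [uIcc_of_le hx.2] at hs
        have hs' : s ∈ uIcc (0 : ℝ) 1 := uIcc_zero_one ▸ ⟨hx.1.trans hs.1, hs.2⟩
        have h2 : ∫ t in (0 : ℝ)..s, σ₁ t * (u - w) t =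
            (∫ t in (0 : ℝ)..s, σ₁ t * u t) - ∫ t in (0 : ℝ)..s, σ₁ t * w t := by
          rw [← intervalIntegral.integral_sub
            ((hiu u hu).mono_set (uIcc_subset_uIcc (by simp) hs'))
            ((hiu w hw).mono_set (uIcc_subset_uIcc (by simp) hs'))]
          congr 1; ext t; simp [mul_sub]
        simp only [m, h2]
        ring
      rw [h1]
      refine (norm_integral_exp_kernel_mul_mul_le hσ₂ hk hε0.le hx (H x hx)).trans ?_
      have h3 : ‖-∫ t in (0 : ℝ)..x, σ₁ t * (u - w) t‖ ≤ b * N := by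
        rw [norm_neg]; exact hint _ hd b hb0 hb x hx
      have h4 : ∫ t in (0 : ℝ)..1, ‖-(σ₁ t * (u - w) t)‖ ≤ b * N := by
        rw [hN, ← intervalIntegral.integral_const_mul]
        refine intervalIntegral.integral_mono_on zero_le_one (hiu _ hd).neg.norm
          (hσ₁.norm.const_mul b) fun t ht => ?_
        rw [norm_neg, norm_mul, mul_comm]
        gcongr
        exact hb t ht
      calc _ ≤ ε * (b * N + b * N) := by gcongr
        _ = 2 * b * (ε * N) := by ring
        _ ≤ 2 * b * (1 / 4) := by gcongr
        _ = b / 2 := by ring)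
  -- The fixed point is compared with `0`: `Φ 0` is the pure oscillatory integral of `σ₂`, at most
  -- `ε`.
  have hu2 : ∀ x ∈ Icc (0 : ℝ) 1, ‖u x‖ ≤ 2 * ε := fun x hx => by
    have := hapr 0 continuousOn_const ε hε0.le (fun y hy => by
      have : Φ 0 y = ∫ s in y..1, Complex.exp (2 * Complex.I * μ * ((s - y : ℝ) : ℂ)) * σ₂ s := by
        simp [Φ, m]
      simp only [Pi.zero_apply, zero_sub, norm_neg, this]
      exact H y hy y ⟨le_rfl, hy.2⟩) x hx
    simpa using this
  refine ⟨m u, u, hm u hu, (hΦ u hu).congr (fun x hx => (hfix x hx).symm)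
    (fun x hx => by simp only [hfix x hx]), by simp [m], ?_, fun x hx => ⟨?_, ?_⟩⟩
  · rw [hfix 1 (by simp)]; simp [Φ]
  · have := hint u hu (2 * ε) (by positivity) hu2 x hx
    have e : m u x - 1 = -∫ s in (0 : ℝ)..x, σ₁ s * u s := by simp [m]
    rw [e, norm_neg]
    linarith
  · linarith [hu2 x hx]

/-! ### Passage between vector solutions and their components -/

lemma isSolution_of_hasACDeriv {M : ℝ → Matrix (Fin 2) (Fin 2) ℂ} {Y : ℝ → Fin 2 → ℂ}
    (h : ∀ i, HasACDeriv (fun x => Y x i) (fun x => M x i 0 * Y x 0 + M x i 1 * Y x 1)) :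
    IsSolution M Y := by
  constructor
  · have cst : ∀ v : Fin 2 → ℂ, AbsolutelyContinuousOnInterval (fun _ : ℝ => v) 0 1 :=
      fun v => contDiffOn_const.absolutelyContinuousOnInterval
    refine absolutelyContinuousOnInterval_congr
      (((h 0).ac.smul (cst ![1, 0])).add ((h 1).ac.smul (cst ![0, 1]))) fun x _ => ?_
    ext i
    fin_cases i <;> simp
  · rw [ae_restrict_iff' measurableSet_Icc]
    filter_upwards [(h 0).deriv, (h 1).deriv] with x h₀ h₁ hx
    rw [hasDerivAt_pi]
    intro i
    fin_cases i
    · simpa [Matrix.mulVec, dotProduct, Fin.sum_univ_two] using h₀ hx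
    · simpa [Matrix.mulVec, dotProduct, Fin.sum_univ_two] using h₁ hx

lemma IsSolution.continuousOn {M : ℝ → Matrix (Fin 2) (Fin 2) ℂ} {Y : ℝ → Fin 2 → ℂ}
    (hY : IsSolution M Y) : ContinuousOn Y (Icc 0 1) :=
  uIcc_zero_one ▸ hY.1.continuousOn

lemma IsSolution.hasACDeriv {M : ℝ → Matrix (Fin 2) (Fin 2) ℂ} {Y : ℝ → Fin 2 → ℂ}
    (hY : IsSolution M Y) (hM : ∀ i j, IntervalIntegrable (fun x => M x i j) volume 0 1)
    (i : Fin 2) :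
    HasACDeriv (fun x => Y x i) (fun x => M x i 0 * Y x 0 + M x i 1 * Y x 1) where
  ac := absolutelyContinuousOnInterval_of_dist_le hY.1 fun x y => dist_le_pi_dist _ _ i
  int := by
    have hc : ∀ j, ContinuousOn (fun x => Y x j) (uIcc 0 1) := fun j =>
      (continuous_apply j).comp_continuousOn hY.1.continuousOn
    exact ((hM i 0).mul_continuousOn (hc 0)).add ((hM i 1).mul_continuousOn (hc 1))
  deriv := by
    have := hY.2
    rw [ae_restrict_iff' measurableSet_Icc] at this
    filter_upwards [this] with x h hx
    simpa [Matrix.mulVec, dotProduct, Fin.sum_univ_two] using hasDerivAt_pi.1 (h hx) i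

/-! ### The unperturbed Dirac system: Wronskian, uniqueness, `W` and `V` -/

section Dirac

variable {σ₁ σ₂ : ℝ → ℂ} {μ : ℂ}

lemma diracCoeff_zero_zero (x : ℝ) : diracCoeff σ₁ σ₂ μ x 0 0 = Complex.I * μ := by
  simp [diracCoeff, matA, matJ]

lemma diracCoeff_zero_one (x : ℝ) : diracCoeff σ₁ σ₂ μ x 0 1 = -σ₁ x := by
  simp [diracCoeff, matA, matJ]

lemma diracCoeff_one_zero (x : ℝ) : diracCoeff σ₁ σ₂ μ x 1 0 = -σ₂ x := by
  simp [diracCoeff, matA, matJ]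

lemma diracCoeff_one_one (x : ℝ) : diracCoeff σ₁ σ₂ μ x 1 1 = -(Complex.I * μ) := by
  simp [diracCoeff, matA, matJ]

lemma intervalIntegrable_diracCoeff (hσ₁ : IntervalIntegrable σ₁ volume 0 1)
    (hσ₂ : IntervalIntegrable σ₂ volume 0 1) (i j : Fin 2) :
    IntervalIntegrable (fun x => diracCoeff σ₁ σ₂ μ x i j) volume 0 1 := by
  fin_cases i <;> fin_cases j
  · simp [diracCoeff_zero_zero]
  · simpa [diracCoeff_zero_one] using! hσ₁.neg
  · simpa [diracCoeff_one_zero] using! hσ₂.neg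
  · simp [diracCoeff_one_one]

/-- The coefficient matrix has trace zero, so the derivative of the determinant vanishes. -/
lemma wronskian_eq (hσ₁ : IntervalIntegrable σ₁ volume 0 1)
    (hσ₂ : IntervalIntegrable σ₂ volume 0 1) {Y Z : ℝ → Fin 2 → ℂ}
    (hY : IsSolution (diracCoeff σ₁ σ₂ μ) Y) (hZ : IsSolution (diracCoeff σ₁ σ₂ μ) Z) {x y : ℝ}
    (hx : x ∈ Icc (0 : ℝ) 1) (hy : y ∈ Icc (0 : ℝ) 1) :
    Y x 0 * Z x 1 - Y x 1 * Z x 0 = Y y 0 * Z y 1 - Y y 1 * Z y 0 := by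
  have hM := intervalIntegrable_diracCoeff (μ := μ) hσ₁ hσ₂
  have h := ((hY.hasACDeriv hM 0).mul (hZ.hasACDeriv hM 1)).sub
    ((hY.hasACDeriv hM 1).mul (hZ.hasACDeriv hM 0))
  refine h.eq_of_deriv_eq_zero (fun t _ => ?_) hx hy
  simp only [diracCoeff_zero_zero, diracCoeff_zero_one, diracCoeff_one_zero, diracCoeff_one_one,
    Pi.zero_apply]
  ring

/-- Cramer's rule: where `det [W, V] ≠ 0`, a vector is determined by its determinants with `W` and
`V`. -/
lemma eqOn_of_wronskian_eq {W V Y F : ℝ → Fin 2 → ℂ}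
    (hd : ∀ x ∈ Icc (0 : ℝ) 1, W x 0 * V x 1 - W x 1 * V x 0 ≠ 0)
    (hW : ∀ x ∈ Icc (0 : ℝ) 1, Y x 0 * W x 1 - Y x 1 * W x 0 = F x 0 * W x 1 - F x 1 * W x 0)
    (hV : ∀ x ∈ Icc (0 : ℝ) 1, Y x 0 * V x 1 - Y x 1 * V x 0 = F x 0 * V x 1 - F x 1 * V x 0) :
    EqOn Y F (Icc 0 1) := by
  intro x hx
  have hd := hd x hx
  have hW := hW x hx
  have hV := hV x hx
  ext i
  fin_cases i
  · refine mul_left_cancel₀ hd ?_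
    simp only [Fin.zero_eta]
    linear_combination W x 0 * hV - V x 0 * hW
  · refine mul_left_cancel₀ hd ?_
    simp only [Fin.mk_one]
    linear_combination W x 1 * hV - V x 1 * hW

lemma wronskian_eq_apply_zero_one (hσ₁ : IntervalIntegrable σ₁ volume 0 1)
    (hσ₂ : IntervalIntegrable σ₂ volume 0 1) {W V : ℝ → Fin 2 → ℂ}
    (hW : IsSolutionW σ₁ σ₂ μ W) (hV : IsSolutionV σ₁ σ₂ μ V) {x : ℝ}
    (hx : x ∈ Icc (0 : ℝ) 1) : W x 0 * V x 1 - W x 1 * V x 0 = V 0 1 := by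
  rw [wronskian_eq hσ₁ hσ₂ hW.1 hV.1 hx (y := 0) (by simp), hW.2.1, hV.2.1]
  ring

/-- The two boundary conditions fix the constant Wronskians with `W` (read off at `1`) and with `V`
(read off at `0`). -/
lemma IsSolutionW.eqOn (hσ₁ : IntervalIntegrable σ₁ volume 0 1)
    (hσ₂ : IntervalIntegrable σ₂ volume 0 1) {W V Y : ℝ → Fin 2 → ℂ}
    (hW : IsSolutionW σ₁ σ₂ μ W) (hV : IsSolutionV σ₁ σ₂ μ V) (hv : V 0 1 ≠ 0)
    (hY : IsSolutionW σ₁ σ₂ μ Y) : EqOn Y W (Icc 0 1) := by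
  refine eqOn_of_wronskian_eq (W := W) (V := V)
    (fun x hx => (wronskian_eq_apply_zero_one hσ₁ hσ₂ hW hV hx).trans_ne hv)
    (fun x hx => ?_) (fun x hx => ?_)
  · rw [wronskian_eq hσ₁ hσ₂ hY.1 hW.1 hx (y := 1) (by simp), hY.2.2, hW.2.2]
    ring
  · rw [wronskian_eq_apply_zero_one hσ₁ hσ₂ hW hV hx, wronskian_eq_apply_zero_one hσ₁ hσ₂ hY hV hx]

lemma IsSolutionV.eqOn (hσ₁ : IntervalIntegrable σ₁ volume 0 1)
    (hσ₂ : IntervalIntegrable σ₂ volume 0 1) {W V Y : ℝ → Fin 2 → ℂ}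
    (hW : IsSolutionW σ₁ σ₂ μ W) (hV : IsSolutionV σ₁ σ₂ μ V) (hv : V 0 1 ≠ 0)
    (hY : IsSolutionV σ₁ σ₂ μ Y) : EqOn Y V (Icc 0 1) := by
  refine eqOn_of_wronskian_eq (W := W) (V := V)
    (fun x hx => (wronskian_eq_apply_zero_one hσ₁ hσ₂ hW hV hx).trans_ne hv)
    (fun x hx => ?_) (fun x hx => ?_)
  · rw [wronskian_eq hσ₁ hσ₂ hY.1 hW.1 hx (y := 1) (by simp),
      wronskian_eq hσ₁ hσ₂ hV.1 hW.1 hx (y := 1) (by simp), hY.2.2, hW.2.2, hV.2.2]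
    ring
  · rw [wronskian_eq hσ₁ hσ₂ hY.1 hV.1 hx (y := 0) (by simp), hY.2.1, hV.2.1]
    ring

lemma norm_exp_I_mul (μ : ℂ) (x : ℝ) :
    ‖Complex.exp (Complex.I * μ * x)‖ = Real.exp (-(μ.im * x)) := by
  rw [Complex.norm_exp]
  congr 1
  simp

/-- The upper bound is needed for the operators `𝒜₁, 𝒜₂`; the lower bound at `1` becomes, after
reflection, the lower bound for `v₂(0)` in their denominator. -/
lemma exists_solutionW (hσ₁ : IntervalIntegrable σ₁ volume 0 1)
    (hσ₂ : IntervalIntegrable σ₂ volume 0 1) {r : ℝ} (hr : 0 ≤ r) :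
    ∃ R : ℝ, 0 < R ∧ ∀ μ : ℂ, -r < μ.im → R < ‖μ‖ → ∃ W, IsSolutionW σ₁ σ₂ μ W ∧
      (∀ x ∈ Icc (0 : ℝ) 1, ‖W x‖ ≤ 2 * Real.exp (-(μ.im * x))) ∧
      Real.exp (-μ.im) / 2 ≤ ‖W 1 0‖ := by
  obtain ⟨R, hR, H⟩ := exists_normalized_solution hσ₁ hσ₂ hr
  refine ⟨R, hR, fun μ hμ hμR => ?_⟩
  obtain ⟨u₁, u₂, h₁, h₂, h10, h21, hb⟩ := H μ hμ hμR
  have he : HasACDeriv (fun x => Complex.exp (Complex.I * μ * x))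
      (fun x => Complex.I * μ * Complex.exp (Complex.I * μ * x)) := by
    simpa using HasACDeriv.exp (Complex.I * μ) 0
  refine ⟨fun x => ![Complex.exp (Complex.I * μ * x) * u₁ x,
      Complex.exp (Complex.I * μ * x) * u₂ x],
    ⟨isSolution_of_hasACDeriv fun i => ?_, by simp [h10], by simp [h21]⟩, fun x hx => ?_, ?_⟩
  · fin_cases i
    · refine (he.mul h₁).congr (fun x _ => by simp) (fun x _ => ?_)
      simp [diracCoeff_zero_zero, diracCoeff_zero_one]
      ring
    · refine (he.mul h₂).congr (fun x _ => by simp) (fun x _ => ?_)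
      simp [diracCoeff_one_zero, diracCoeff_one_one]
      ring
  · obtain ⟨b₁, b₂⟩ := hb x hx
    have b₁' : ‖u₁ x‖ ≤ 2 := by
      have := norm_le_norm_add_norm_sub' (u₁ x) 1
      rw [norm_one] at this
      linarith
    rw [pi_norm_le_iff_of_nonneg (by positivity)]
    intro i
    fin_cases i
    · simp only [Fin.zero_eta, Matrix.cons_val_zero, norm_mul, norm_exp_I_mul]
      rw [mul_comm]
      gcongr
    · simp only [Fin.mk_one, Matrix.cons_val_one, Matrix.cons_val_fin_one, norm_mul,
        norm_exp_I_mul]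
      rw [mul_comm]
      gcongr
      linarith
  · have b₁ := (hb 1 (by simp)).1
    have : 1 / 2 ≤ ‖u₁ 1‖ := by
      have := norm_le_norm_add_norm_sub (u₁ 1) 1
      rw [norm_one] at this
      linarith
    simp only [Matrix.cons_val_zero, norm_mul, norm_exp_I_mul, mul_one]
    rw [div_eq_mul_one_div]
    gcongr

/-- Reflecting `x ↦ 1 - x` and swapping components turns the problem for `V` into that for `W` with
potentials `-σ₂(1 - x)`, `-σ₁(1 - x)`; then `v₂(0) = w₁(1)`. -/
lemma exists_solutionV (hσ₁ : IntervalIntegrable σ₁ volume 0 1)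
    (hσ₂ : IntervalIntegrable σ₂ volume 0 1) {r : ℝ} (hr : 0 ≤ r) :
    ∃ R : ℝ, 0 < R ∧ ∀ μ : ℂ, -r < μ.im → R < ‖μ‖ → ∃ V, IsSolutionV σ₁ σ₂ μ V ∧
      (∀ x ∈ Icc (0 : ℝ) 1, ‖V x‖ ≤ 2 * Real.exp (-(μ.im * (1 - x)))) ∧
      Real.exp (-μ.im) / 2 ≤ ‖V 0 1‖ := by
  have hr₁ : IntervalIntegrable (fun x => -σ₂ (1 - x)) volume 0 1 := by
    simpa using! (hσ₂.comp_sub_left 1).symm.neg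
  have hr₂ : IntervalIntegrable (fun x => -σ₁ (1 - x)) volume 0 1 := by
    simpa using! (hσ₁.comp_sub_left 1).symm.neg
  obtain ⟨R, hR, H⟩ := exists_solutionW hr₁ hr₂ hr
  refine ⟨R, hR, fun μ hμ hμR => ?_⟩
  obtain ⟨W, ⟨hW, h0, h1⟩, hb, hv⟩ := H μ hμ hμR
  have hM := intervalIntegrable_diracCoeff (μ := μ) hr₁ hr₂
  refine ⟨fun x => ![W (1 - x) 1, W (1 - x) 0],
    ⟨isSolution_of_hasACDeriv fun i => ?_, by simp [h1], by simp [h0]⟩, fun x hx => ?_, ?_⟩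
  · fin_cases i
    · refine (hW.hasACDeriv hM 1).reflect.congr (fun x _ => by simp) (fun x _ => ?_)
      simp [diracCoeff_zero_zero, diracCoeff_zero_one, diracCoeff_one_zero, diracCoeff_one_one]
    · refine (hW.hasACDeriv hM 0).reflect.congr (fun x _ => by simp) (fun x _ => ?_)
      simp [diracCoeff_zero_zero, diracCoeff_zero_one, diracCoeff_one_zero, diracCoeff_one_one]
  · have h := hb (1 - x) ⟨by linarith [hx.2], by linarith [hx.1]⟩
    refine le_trans ?_ h
    rw [pi_norm_le_iff_of_nonneg (norm_nonneg _)]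
    intro i
    fin_cases i
    · exact norm_le_pi_norm (W (1 - x)) 1
    · exact norm_le_pi_norm (W (1 - x)) 0
  · simpa using hv

end Dirac

/-- Evaluating a vanishing combination in component `0` at `0`, then in component `1` at `1`, is a
triangular system. -/
lemma isFundamentalSystem_of_boundary_values {M : ℝ → Matrix (Fin 2) (Fin 2) ℂ}
    {Y Z : ℝ → Fin 2 → ℂ} (hY : IsSolution M Y) (hZ : IsSolution M Z) (hY0 : Y 0 0 = 1)
    (hZ0 : Z 0 0 = 0) (hZ1 : Z 1 1 = 1) : IsFundamentalSystem M Y Z := by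
  refine ⟨hY, hZ, LinearIndependent.pair_iff.2 fun a b h => ?_⟩
  have h0 := congrFun (congrFun h ⟨0, by simp⟩) 0
  have h1 := congrFun (congrFun h ⟨1, by simp⟩) 1
  simp [hY0, hZ0] at h0
  simp [h0, hZ1] at h1
  exact ⟨h0, h1⟩

/-! ### The operators `𝒜₁, 𝒜₂` and the perturbed system -/

section Perturbation

/-- The operators `𝒜₁` and `𝒜₂` with a general weight `e` in place of the exponentials. -/
def weightedOp (P : ℝ → Matrix (Fin 2) (Fin 2) ℂ) (e : ℝ → ℂ) (W V Z : ℝ → Fin 2 → ℂ) (x : ℝ) :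
    Fin 2 → ℂ :=
  ((e x)⁻¹ / V 0 1) • (matD W V x).mulVec
    ![∫ t in (0 : ℝ)..x, e t * Q₁ P V Z t, -∫ t in x..(1 : ℝ), e t * Q₂ P W Z t]

lemma opA₁_eq_weightedOp (P : ℝ → Matrix (Fin 2) (Fin 2) ℂ) (μ : ℂ) (W V Z : ℝ → Fin 2 → ℂ) :
    opA₁ P μ W V Z = weightedOp P (fun x => Complex.exp (Complex.I * μ * x)) W V Z := by
  ext1 x
  simp only [opA₁, weightedOp, ← Complex.exp_neg, neg_mul]

lemma opA₂_eq_weightedOp (P : ℝ → Matrix (Fin 2) (Fin 2) ℂ) (μ : ℂ) (W V Z : ℝ → Fin 2 → ℂ) :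
    opA₂ P μ W V Z = weightedOp P (fun x => Complex.exp (Complex.I * μ * (1 - x))) W V Z := by
  ext1 x
  simp only [opA₂, weightedOp, ← Complex.exp_neg, neg_mul]

variable {P : ℝ → Matrix (Fin 2) (Fin 2) ℂ}

/-- Both integrands come from one bilinear form, so a single estimate serves both; the sign cancels
the minus in the definition of the operators. -/
lemma Q₂_eq_neg_Q₁ (W Z : ℝ → Fin 2 → ℂ) (t : ℝ) : Q₂ P W Z t = -Q₁ P W Z t := by
  simp only [Q₁, Q₂]; ring

lemma weightedOp_apply (e : ℝ → ℂ) (W V Z : ℝ → Fin 2 → ℂ) (x : ℝ) (i : Fin 2) :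
    weightedOp P e W V Z x i = (e x)⁻¹ / V 0 1 *
      (W x i * (∫ t in (0 : ℝ)..x, e t * Q₁ P V Z t) +
        V x i * ∫ t in x..(1 : ℝ), e t * Q₁ P W Z t) := by
  fin_cases i <;>
  · simp [weightedOp, matD, Q₂_eq_neg_Q₁]
    left; ring

lemma Q₁_smul (e : ℝ → ℂ) (V Z : ℝ → Fin 2 → ℂ) (t : ℝ) :
    Q₁ P V (fun x => e x • Z x) t = e t * Q₁ P V Z t := by
  simp only [Q₁, Pi.smul_apply, smul_eq_mul]; ring

lemma Q₁_sub (V Z Z' : ℝ → Fin 2 → ℂ) (t : ℝ) :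
    Q₁ P V (Z - Z') t = Q₁ P V Z t - Q₁ P V Z' t := by
  simp only [Q₁, Pi.sub_apply]; ring

/-- The sum of the norms of the entries of `P t`. -/
def entryNorm (P : ℝ → Matrix (Fin 2) (Fin 2) ℂ) (t : ℝ) : ℝ :=
  ‖P t 0 0‖ + ‖P t 0 1‖ + ‖P t 1 0‖ + ‖P t 1 1‖

lemma entryNorm_nonneg (t : ℝ) : 0 ≤ entryNorm P t := by
  unfold entryNorm; positivity

lemma intervalIntegrable_entryNorm (hP : ∀ i j, IntervalIntegrable (fun x => P x i j) volume 0 1) :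
    IntervalIntegrable (entryNorm P) volume 0 1 :=
  (((hP 0 0).norm.add (hP 0 1).norm).add (hP 1 0).norm).add (hP 1 1).norm

lemma norm_Q₁_le (V Z : ℝ → Fin 2 → ℂ) (t : ℝ) :
    ‖Q₁ P V Z t‖ ≤ ‖V t‖ * ‖Z t‖ * entryNorm P t := by
  have key : ∀ i j k l, ‖V t i * P t k l * Z t j‖ ≤ ‖V t‖ * ‖Z t‖ * ‖P t k l‖ := by
    intro i j k l
    rw [norm_mul, norm_mul]
    calc _ ≤ ‖V t‖ * ‖P t k l‖ * ‖Z t‖ := by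
          gcongr <;> apply norm_le_pi_norm
      _ = _ := by ring
  have e : Q₁ P V Z t = V t 1 * P t 0 0 * Z t 0 - V t 0 * P t 1 0 * Z t 0 +
      (V t 1 * P t 0 1 * Z t 1 - V t 0 * P t 1 1 * Z t 1) := by
    simp only [Q₁]; ring
  rw [e]
  calc _ ≤ ‖V t 1 * P t 0 0 * Z t 0‖ + ‖V t 0 * P t 1 0 * Z t 0‖ +
        (‖V t 1 * P t 0 1 * Z t 1‖ + ‖V t 0 * P t 1 1 * Z t 1‖) :=
        (norm_add_le _ _).trans (add_le_add (norm_sub_le _ _) (norm_sub_le _ _))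
    _ ≤ ‖V t‖ * ‖Z t‖ * ‖P t 0 0‖ + ‖V t‖ * ‖Z t‖ * ‖P t 1 0‖ +
        (‖V t‖ * ‖Z t‖ * ‖P t 0 1‖ + ‖V t‖ * ‖Z t‖ * ‖P t 1 1‖) := by
        gcongr <;> apply key
    _ = _ := by simp only [entryNorm]; ring

lemma intervalIntegrable_Q₁ (hP : ∀ i j, IntervalIntegrable (fun x => P x i j) volume 0 1)
    {V Z : ℝ → Fin 2 → ℂ} (hV : ContinuousOn V (Icc 0 1)) (hZ : ContinuousOn Z (Icc 0 1)) :
    IntervalIntegrable (Q₁ P V Z) volume 0 1 := by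
  have hV' : ∀ i, ContinuousOn (fun x => V x i) (uIcc 0 1) := fun i =>
    (continuous_apply i).comp_continuousOn (uIcc_zero_one ▸ hV)
  have hZ' : ∀ i, ContinuousOn (fun x => Z x i) (uIcc 0 1) := fun i =>
    (continuous_apply i).comp_continuousOn (uIcc_zero_one ▸ hZ)
  exact ((((hP 0 0).continuousOn_mul (hV' 1)).sub ((hP 1 0).continuousOn_mul (hV' 0))).mul_continuousOn
    (hZ' 0)).add ((((hP 0 1).continuousOn_mul (hV' 1)).sub
      ((hP 1 1).continuousOn_mul (hV' 0))).mul_continuousOn (hZ' 1))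

section Weighted

variable {W V : ℝ → Fin 2 → ℂ} {e : ℝ → ℂ} {m r : ℝ}

/-- For `t ≤ x`, `‖W x‖ ‖V t‖ / ‖V 0 1‖ ≤ 8 e^{-m(x-t)}`, and `‖e t‖ / ‖e x‖ ≤ e^{2r} e^{m|x-t|}`
cancels this decay or growth exactly; `t ≥ x` is symmetric. Each half contributes `8 e^{2r}`, whence
the constant `16`. -/
lemma norm_weightedOp_le (hP : ∀ i j, IntervalIntegrable (fun x => P x i j) volume 0 1)
    (hWb : ∀ x ∈ Icc (0 : ℝ) 1, ‖W x‖ ≤ 2 * Real.exp (-(m * x)))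
    (hVb : ∀ x ∈ Icc (0 : ℝ) 1, ‖V x‖ ≤ 2 * Real.exp (-(m * (1 - x))))
    (hv : Real.exp (-m) / 2 ≤ ‖V 0 1‖) (he0 : ∀ x, e x ≠ 0)
    (hee : ∀ x ∈ Icc (0 : ℝ) 1, ∀ t ∈ Icc (0 : ℝ) 1,
      ‖e t‖ ≤ Real.exp (2 * r) * ‖e x‖ * Real.exp (m * |x - t|))
    {Z : ℝ → Fin 2 → ℂ} {b : ℝ} (hb : 0 ≤ b) (hZ : ∀ x ∈ Icc (0 : ℝ) 1, ‖Z x‖ ≤ b)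
    {x : ℝ} (hx : x ∈ Icc (0 : ℝ) 1) :
    ‖weightedOp P e W V Z x‖ ≤
      16 * Real.exp (2 * r) * (∫ t in (0 : ℝ)..1, entryNorm P t) * b := by
  set N := ∫ t in (0 : ℝ)..1, entryNorm P t with hN
  have hN0 : 0 ≤ N := intervalIntegral.integral_nonneg zero_le_one fun t _ => entryNorm_nonneg t
  have hn := intervalIntegrable_entryNorm hP
  have hex : 0 < ‖e x‖ := norm_pos_iff.2 (he0 x)
  have h1 : ‖∫ t in (0 : ℝ)..x, e t * Q₁ P V Z t‖ ≤
      2 * Real.exp (2 * r) * ‖e x‖ * Real.exp (-(m * (1 - x))) * b * N := by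
    refine norm_integral_le_of_norm_le_mul hx.1 (by simp) hx (by positivity) hn entryNorm_nonneg
      fun t ht => ?_
    have ht' : t ∈ Icc (0 : ℝ) 1 := ⟨ht.1, ht.2.trans hx.2⟩
    calc ‖e t * Q₁ P V Z t‖ ≤ (Real.exp (2 * r) * ‖e x‖ * Real.exp (m * |x - t|)) *
          ((2 * Real.exp (-(m * (1 - t)))) * b * entryNorm P t) := by
          rw [norm_mul]
          have := entryNorm_nonneg (P := P) t
          gcongr
          · exact hee x hx t ht'
          · refine (norm_Q₁_le _ _ _).trans ?_
            gcongr
            · exact hVb t ht'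
            · exact hZ t ht'
      _ = 2 * Real.exp (2 * r) * ‖e x‖ * (Real.exp (m * |x - t|) * Real.exp (-(m * (1 - t)))) *
          b * entryNorm P t := by ring
      _ = _ := by
          rw [← Real.exp_add, abs_of_nonneg (by linarith [ht.2])]
          congr 4
          ring_nf
  have h2 : ‖∫ t in x..(1 : ℝ), e t * Q₁ P W Z t‖ ≤
      2 * Real.exp (2 * r) * ‖e x‖ * Real.exp (-(m * x)) * b * N := by
    refine norm_integral_le_of_norm_le_mul hx.2 hx (by simp) (by positivity) hn entryNorm_nonneg
      fun t ht => ?_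
    have ht' : t ∈ Icc (0 : ℝ) 1 := ⟨hx.1.trans ht.1, ht.2⟩
    calc ‖e t * Q₁ P W Z t‖ ≤ (Real.exp (2 * r) * ‖e x‖ * Real.exp (m * |x - t|)) *
          ((2 * Real.exp (-(m * t))) * b * entryNorm P t) := by
          rw [norm_mul]
          have := entryNorm_nonneg (P := P) t
          gcongr
          · exact hee x hx t ht'
          · refine (norm_Q₁_le _ _ _).trans ?_
            gcongr
            · exact hWb t ht'
            · exact hZ t ht'
      _ = 2 * Real.exp (2 * r) * ‖e x‖ * (Real.exp (m * |x - t|) * Real.exp (-(m * t))) *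
          b * entryNorm P t := by ring
      _ = _ := by
          rw [← Real.exp_add, abs_of_nonpos (by linarith [ht.1])]
          congr 4
          ring_nf
  have h3 : ‖V 0 1‖⁻¹ ≤ 2 * Real.exp m := by
    rw [← inv_inv (2 * Real.exp m)]
    refine inv_anti₀ (by positivity) (le_of_eq_of_le ?_ hv)
    rw [Real.exp_neg, mul_inv]; ring
  rw [pi_norm_le_iff_of_nonneg (by positivity)]
  intro i
  rw [weightedOp_apply, norm_mul, norm_div, norm_inv, div_eq_mul_inv]
  calc _ ≤ ‖e x‖⁻¹ * (2 * Real.exp m) *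
        ((2 * Real.exp (-(m * x))) *
            (2 * Real.exp (2 * r) * ‖e x‖ * Real.exp (-(m * (1 - x))) * b * N) +
          (2 * Real.exp (-(m * (1 - x)))) *
            (2 * Real.exp (2 * r) * ‖e x‖ * Real.exp (-(m * x)) * b * N)) := by
        gcongr
        refine (norm_add_le _ _).trans ?_
        rw [norm_mul, norm_mul]
        gcongr
        · exact (norm_le_pi_norm _ i).trans (hWb x hx)
        · exact (norm_le_pi_norm _ i).trans (hVb x hx)
    _ = 16 * Real.exp (2 * r) * N * b * (‖e x‖⁻¹ * ‖e x‖) *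
        (Real.exp m * (Real.exp (-(m * x)) * Real.exp (-(m * (1 - x))))) := by ring
    _ = _ := by
        rw [inv_mul_cancel₀ hex.ne', ← Real.exp_add, ← Real.exp_add]
        have : m + (-(m * x) + -(m * (1 - x))) = 0 := by ring
        rw [this, Real.exp_zero]; ring

lemma intervalIntegrable_mul_Q₁
    (hP : ∀ i j, IntervalIntegrable (fun x => P x i j) volume 0 1) (he : Continuous e)
    {Y Z : ℝ → Fin 2 → ℂ} (hY : ContinuousOn Y (Icc 0 1)) (hZ : ContinuousOn Z (Icc 0 1)) :
    IntervalIntegrable (fun t => e t * Q₁ P Y Z t) volume 0 1 :=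
  (intervalIntegrable_Q₁ hP hY hZ).continuousOn_mul he.continuousOn

lemma weightedOp_sub (hP : ∀ i j, IntervalIntegrable (fun x => P x i j) volume 0 1)
    (hW : ContinuousOn W (Icc 0 1)) (hV : ContinuousOn V (Icc 0 1)) (he : Continuous e)
    {Z Z' : ℝ → Fin 2 → ℂ} (hZ : ContinuousOn Z (Icc 0 1))
    (hZ' : ContinuousOn Z' (Icc 0 1)) {x : ℝ} (hx : x ∈ Icc (0 : ℝ) 1) :
    weightedOp P e W V (Z - Z') x = weightedOp P e W V Z x - weightedOp P e W V Z' x := by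
  have hint : ∀ Y : ℝ → Fin 2 → ℂ, ContinuousOn Y (Icc 0 1) → ∀ a ∈ Icc (0 : ℝ) 1,
      ∀ b ∈ Icc (0 : ℝ) 1, ∫ t in a..b, e t * Q₁ P Y (Z - Z') t =
        (∫ t in a..b, e t * Q₁ P Y Z t) - ∫ t in a..b, e t * Q₁ P Y Z' t := by
    intro Y hY a ha b hb
    have hs : uIcc a b ⊆ uIcc 0 1 := uIcc_subset_uIcc (uIcc_zero_one ▸ ha) (uIcc_zero_one ▸ hb)
    rw [← intervalIntegral.integral_sub ((intervalIntegrable_mul_Q₁ hP he hY hZ).mono_set hs)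
      ((intervalIntegrable_mul_Q₁ hP he hY hZ').mono_set hs)]
    simp only [Q₁_sub, mul_sub]
  ext i
  rw [Pi.sub_apply, weightedOp_apply, weightedOp_apply, weightedOp_apply,
    hint V hV 0 (by simp) x hx, hint W hW x hx 1 (by simp)]
  ring

lemma continuousOn_weightedOp (hP : ∀ i j, IntervalIntegrable (fun x => P x i j) volume 0 1)
    (hW : ContinuousOn W (Icc 0 1)) (hV : ContinuousOn V (Icc 0 1)) (he : Continuous e)
    (he0 : ∀ x, e x ≠ 0) {Z : ℝ → Fin 2 → ℂ} (hZ : ContinuousOn Z (Icc 0 1)) :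
    ContinuousOn (weightedOp P e W V Z) (Icc 0 1) := by
  rw [continuousOn_pi]
  intro i
  simp only [weightedOp_apply]
  have hWi : ContinuousOn (fun x => W x i) (Icc 0 1) := (continuous_apply i).comp_continuousOn hW
  have hVi : ContinuousOn (fun x => V x i) (Icc 0 1) := (continuous_apply i).comp_continuousOn hV
  have h1 := (HasACDeriv.primitive (intervalIntegrable_mul_Q₁ hP he hV hZ) (c := 0)
    (by simp)).continuousOn
  have h2 := (HasACDeriv.primitive_right (intervalIntegrable_mul_Q₁ hP he hW hZ)).continuousOn
  exact ((he.inv₀ he0).continuousOn.div_const _).mul ((hWi.mul h1).add (hVi.mul h2))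

end Weighted

lemma perturbedCoeff_apply (σ₁ σ₂ : ℝ → ℂ) (μ : ℂ) (x : ℝ) (i j : Fin 2) :
    perturbedCoeff σ₁ σ₂ P μ x i j = diracCoeff σ₁ σ₂ μ x i j + μ⁻¹ * P x i j := by
  simp [perturbedCoeff, diracCoeff]

/-- Variation of constants: `F` is `W` or `V`, and the sought solution is `e • z` with `z = e⁻¹F +
μ⁻¹𝒜z`. Since `‖𝒜‖ ≤ K` and `2K ≤ |μ|`, this is a contraction. -/
lemma exists_perturbed_solution {σ₁ σ₂ : ℝ → ℂ} {W V F : ℝ → Fin 2 → ℂ} {e : ℝ → ℂ} {μ : ℂ} {r : ℝ}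
    (hσ₁ : IntervalIntegrable σ₁ volume 0 1) (hσ₂ : IntervalIntegrable σ₂ volume 0 1)
    (hP : ∀ i j, IntervalIntegrable (fun x => P x i j) volume 0 1)
    (hW : IsSolutionW σ₁ σ₂ μ W) (hV : IsSolutionV σ₁ σ₂ μ V)
    (hWb : ∀ x ∈ Icc (0 : ℝ) 1, ‖W x‖ ≤ 2 * Real.exp (-(μ.im * x)))
    (hVb : ∀ x ∈ Icc (0 : ℝ) 1, ‖V x‖ ≤ 2 * Real.exp (-(μ.im * (1 - x))))
    (hv : Real.exp (-μ.im) / 2 ≤ ‖V 0 1‖)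
    (he : Continuous e) (he0 : ∀ x, e x ≠ 0)
    (hee : ∀ x ∈ Icc (0 : ℝ) 1, ∀ t ∈ Icc (0 : ℝ) 1,
      ‖e t‖ ≤ Real.exp (2 * r) * ‖e x‖ * Real.exp (μ.im * |x - t|))
    (hF : IsSolution (diracCoeff σ₁ σ₂ μ) F)
    (hFb : ∀ x ∈ Icc (0 : ℝ) 1, ‖F x‖ ≤ 2 * ‖e x‖) {K : ℝ}
    (hK : K = 16 * Real.exp (2 * r) * ∫ t in (0 : ℝ)..1, entryNorm P t)
    (hμ0 : 0 < ‖μ‖) (hμ : 2 * K ≤ ‖μ‖) :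
    ∃ Ft, IsSolution (perturbedCoeff σ₁ σ₂ P μ) Ft ∧ Ft 0 0 = F 0 0 ∧ Ft 1 1 = F 1 1 ∧
      ∀ x ∈ Icc (0 : ℝ) 1, ‖Ft x - (F x + (e x / μ) •
        weightedOp P e W V (fun t => (e t)⁻¹ • F t) x)‖ ≤ ‖e x‖ * (4 * K ^ 2 / ‖μ‖ ^ 2) := by
  have hWc := hW.1.continuousOn
  have hVc := hV.1.continuousOn
  have hFc := hF.continuousOn
  have hK0 : 0 ≤ K := by
    rw [hK]
    have : 0 ≤ ∫ t in (0 : ℝ)..1, entryNorm P t :=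
      intervalIntegral.integral_nonneg zero_le_one fun t _ => entryNorm_nonneg t
    positivity
  have hbound : ∀ Z : ℝ → Fin 2 → ℂ, ∀ b, 0 ≤ b → (∀ x ∈ Icc (0 : ℝ) 1, ‖Z x‖ ≤ b) →
      ∀ x ∈ Icc (0 : ℝ) 1, ‖weightedOp P e W V Z x‖ ≤ K * b := fun Z b hb hZ x hx => by
    rw [hK]; exact norm_weightedOp_le hP hWb hVb hv he0 hee hb hZ hx
  set G : ℝ → Fin 2 → ℂ := fun t => (e t)⁻¹ • F t with hG
  have hGc : ContinuousOn G (Icc 0 1) := (he.inv₀ he0).continuousOn.smul hFc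
  have hGb : ∀ x ∈ Icc (0 : ℝ) 1, ‖G x‖ ≤ 2 := fun x hx => by
    have h0 : 0 < ‖e x‖ := norm_pos_iff.2 (he0 x)
    rw [hG, norm_smul, norm_inv, inv_mul_le_iff₀ h0, mul_comm]
    exact hFb x hx
  have hΦc : ∀ z, ContinuousOn z (Icc 0 1) →
      ContinuousOn (fun x => G x + μ⁻¹ • weightedOp P e W V z x) (Icc 0 1) := fun z hz => by
    have := continuousOn_weightedOp hP hWc hVc he he0 hz
    fun_prop
  obtain ⟨z, hz, hfix, hapr⟩ := exists_fixedPoint_of_contracting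
    (fun z x => G x + μ⁻¹ • weightedOp P e W V z x) hΦc (fun z w hz hw b hb x hx => by
      have hb0 : 0 ≤ b := (norm_nonneg _).trans (hb 0 (by simp))
      rw [add_sub_add_left_eq_sub, ← smul_sub, ← weightedOp_sub hP hWc hVc he hz hw hx, norm_smul,
        norm_inv, inv_mul_le_iff₀ hμ0]
      refine (hbound (z - w) b hb0 hb x hx).trans ?_
      nlinarith)
  -- `G` misses being a fixed point by `μ⁻¹𝒜G`, of size at most `2K / |μ|`; the a priori estimate
  -- doubles this.
  have hzG : ∀ x ∈ Icc (0 : ℝ) 1, ‖z x - G x‖ ≤ 4 * K / ‖μ‖ := fun x hx => by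
    refine (hapr G hGc (K * 2 / ‖μ‖) (by positivity) (fun y hy => ?_) x hx).trans
      (le_of_eq (by ring))
    rw [sub_add_cancel_left, norm_neg, norm_smul, norm_inv, inv_mul_eq_div]
    gcongr
    exact hbound G 2 (by norm_num) hGb y hy
  set Ft : ℝ → Fin 2 → ℂ := fun x => e x • z x with hFt
  have hFtc : ContinuousOn Ft (Icc 0 1) := he.continuousOn.smul hz
  have hv0 : V 0 1 ≠ 0 := norm_pos_iff.1 (lt_of_lt_of_le (by positivity) hv)
  have hQ : ∀ Y t, e t * Q₁ P Y z t = Q₁ P Y Ft t := fun Y t => (Q₁_smul e Y z t).symm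
  have hFti : ∀ x ∈ Icc (0 : ℝ) 1, ∀ i, F x i + μ⁻¹ / V 0 1 *
      (W x i * (∫ t in (0 : ℝ)..x, Q₁ P V Ft t) + V x i * ∫ t in x..(1 : ℝ), Q₁ P W Ft t) =
      Ft x i := fun x hx i => by
    have h := congrFun (hfix x hx) i
    simp only [hG, Pi.add_apply, Pi.smul_apply, smul_eq_mul, weightedOp_apply, hQ] at h
    simp only [hFt, Pi.smul_apply, smul_eq_mul, h]
    have := he0 x
    field_simp
  refine ⟨Ft, isSolution_of_hasACDeriv fun i => ?_, ?_, ?_, fun x hx => ?_⟩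
  · have hM := intervalIntegrable_diracCoeff (μ := μ) hσ₁ hσ₂
    have hA := HasACDeriv.primitive (intervalIntegrable_Q₁ hP hVc hFtc) (c := 0) (by simp)
    have hB := HasACDeriv.primitive_right (intervalIntegrable_Q₁ hP hWc hFtc)
    have hD := (hF.hasACDeriv hM i).add ((((hW.1.hasACDeriv hM i).mul hA).add
      ((hV.1.hasACDeriv hM i).mul hB)).const_mul (μ⁻¹ / V 0 1))
    refine hD.congr (fun x hx => hFti x hx i) (fun x hx => ?_)
    have hw := wronskian_eq_apply_zero_one hσ₁ hσ₂ hW hV hx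
    -- Differentiating the two limits of integration leaves this combination; by Cramer's rule it
    -- equals `det D` times `P Ft`, and the determinant cancels the prefactor.
    have key : W x i * Q₁ P V Ft x - V x i * Q₁ P W Ft x =
        V 0 1 * (P x i 0 * Ft x 0 + P x i 1 * Ft x 1) := by
      rw [← hw]
      simp only [Q₁]
      fin_cases i
      · simp only [Fin.zero_eta]; ring
      · simp only [Fin.mk_one]; ring
    simp only [perturbedCoeff_apply]
    have key' : μ⁻¹ / V 0 1 * (W x i * Q₁ P V Ft x - V x i * Q₁ P W Ft x) =
        μ⁻¹ * (P x i 0 * Ft x 0 + P x i 1 * Ft x 1) := by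
      rw [key]; field_simp
    linear_combination key' + diracCoeff σ₁ σ₂ μ x i 0 * hFti x hx 0 +
      diracCoeff σ₁ σ₂ μ x i 1 * hFti x hx 1
  -- At each endpoint one integral is empty and the other is multiplied by a vanishing boundary
  -- value (`v₁(0)`, resp. `w₂(1)`), so the boundary values of `F` persist and give linear
  -- independence later.
  · rw [← hFti 0 (by simp) 0, hV.2.1]; simp
  · rw [← hFti 1 (by simp) 1, hW.2.2]; simp
  -- The error is one more application of `μ⁻¹𝒜` to `z - G`, which is already `O(|μ|⁻¹)`.
  · have h1 : Ft x - (F x + (e x / μ) • weightedOp P e W V G x) =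
        (e x / μ) • weightedOp P e W V (z - G) x := by
      rw [weightedOp_sub hP hWc hVc he hz hGc hx, smul_sub]
      have : Ft x = F x + (e x / μ) • weightedOp P e W V z x := by
        rw [hFt]
        simp only
        conv_lhs => rw [hfix x hx]
        simp only [hG, smul_add, smul_smul, mul_inv_cancel₀ (he0 x), one_smul, div_eq_mul_inv]
      rw [this]
      abel
    rw [h1, norm_smul, norm_div]
    calc _ ≤ ‖e x‖ / ‖μ‖ * (K * (4 * K / ‖μ‖)) := by
          gcongr
          exact hbound _ _ (by positivity) hzG x hx
      _ = _ := by ring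

end Perturbation

/-- For `m ≥ 0` the `2r` is slack; for `-r < m < 0`, replacing `|m|` by `m` costs `2|m||x - t| ≤
2r`. This supplies the weight hypothesis for both exponentials. -/
lemma abs_mul_sub_le {m r x t : ℝ} (hr : 0 ≤ r) (hm : -r < m) (hx : x ∈ Icc (0 : ℝ) 1)
    (ht : t ∈ Icc (0 : ℝ) 1) : |m * (x - t)| ≤ 2 * r + m * |x - t| := by
  have h1 : |x - t| ≤ 1 := by
    rw [abs_le]; constructor <;> linarith [hx.1, hx.2, ht.1, ht.2]
  have h0 := abs_nonneg (x - t)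
  rw [abs_mul]
  rcases abs_cases m with ⟨h, -⟩ | ⟨h, -⟩ <;> rw [h] <;> nlinarith

end DiracSystem
end

/-! ### Assembly of the theorem -/

theorem mainTheorem5 (p : ENNReal) (hp₁ : 1 ≤ p) (hp₂ : p ≤ 2)
    (σ₁ σ₂ : ℝ → ℂ)
    (hσ₁ : MemLp σ₁ p (volume.restrict (Icc (0 : ℝ) 1)))
    (hσ₂ : MemLp σ₂ p (volume.restrict (Icc (0 : ℝ) 1)))
    (P : ℝ → Matrix (Fin 2) (Fin 2) ℂ)
    (hP : ∀ i j, MemLp (fun x => P x i j) p (volume.restrict (Icc (0 : ℝ) 1)))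
    (r : ℝ) (hr : 0 ≤ r) :
    ∃ R : ℝ, 0 < R ∧ ∃ C : ℝ, ∃ W V Wt Vt : ℂ → ℝ → Fin 2 → ℂ,
      ∀ μ ∈ DiracSystem.halfPlane r, R < ‖μ‖ →
        -- `W`, `V` are the unique solutions with the prescribed boundary values
        (DiracSystem.IsSolutionW σ₁ σ₂ μ (W μ) ∧
          ∀ Y, DiracSystem.IsSolutionW σ₁ σ₂ μ Y → EqOn Y (W μ) (Icc (0 : ℝ) 1)) ∧
        (DiracSystem.IsSolutionV σ₁ σ₂ μ (V μ) ∧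
          ∀ Y, DiracSystem.IsSolutionV σ₁ σ₂ μ Y → EqOn Y (V μ) (Icc (0 : ℝ) 1)) ∧
        DiracSystem.IsFundamentalSystem (DiracSystem.diracCoeff σ₁ σ₂ μ) (W μ) (V μ) ∧
        V μ 0 1 ≠ 0 ∧
        -- `Wt`, `Vt` are a fundamental system of the perturbed system
        DiracSystem.IsFundamentalSystem (DiracSystem.perturbedCoeff σ₁ σ₂ P μ) (Wt μ) (Vt μ) ∧
        -- the asymptotic formulas, uniformly in `x`
        (∀ x ∈ Icc (0 : ℝ) 1,
          ‖Wt μ x - (W μ x + (Complex.exp (Complex.I * μ * x) / μ) •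
              DiracSystem.opA₁ P μ (W μ) (V μ)
                (fun t => Complex.exp (-Complex.I * μ * t) • W μ t) x)‖
            ≤ ‖Complex.exp (Complex.I * μ * x)‖ * (C / ‖μ‖ ^ 2)) ∧
        (∀ x ∈ Icc (0 : ℝ) 1,
          ‖Vt μ x - (V μ x + (Complex.exp (Complex.I * μ * (1 - x)) / μ) •
              DiracSystem.opA₂ P μ (W μ) (V μ)
                (fun t => Complex.exp (-Complex.I * μ * (1 - t)) • V μ t) x)‖
            ≤ ‖Complex.exp (Complex.I * μ * (1 - x))‖ * (C / ‖μ‖ ^ 2)) := by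

  have hint : ∀ f : ℝ → ℂ, MemLp f p (volume.restrict (Icc (0 : ℝ) 1)) →
      IntervalIntegrable f volume 0 1 := fun f hf =>
    (intervalIntegrable_iff_integrableOn_Icc_of_le zero_le_one).2 (hf.integrable hp₁)
  have hσ₁ := hint _ hσ₁
  have hσ₂ := hint _ hσ₂
  have hP := fun i j => hint _ (hP i j)
  obtain ⟨R₁, hR₁, H₁⟩ := DiracSystem.exists_solutionW hσ₁ hσ₂ hr
  obtain ⟨R₂, hR₂, H₂⟩ := DiracSystem.exists_solutionV hσ₁ hσ₂ hr
  obtain ⟨K, hK⟩ : ∃ K, K = 16 * Real.exp (2 * r) * ∫ t in (0 : ℝ)..1, DiracSystem.entryNorm P t :=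
    ⟨_, rfl⟩
  -- The conditions on `μ` sit inside the existential, with zero functions as default values, so
  -- that choice yields families indexed by all of `ℂ`.
  have main : ∀ μ : ℂ, ∃ W V Wt Vt : ℝ → Fin 2 → ℂ,
      μ ∈ DiracSystem.halfPlane r → max (max R₁ R₂) (2 * K) < ‖μ‖ →
        (DiracSystem.IsSolutionW σ₁ σ₂ μ W ∧
          ∀ Y, DiracSystem.IsSolutionW σ₁ σ₂ μ Y → EqOn Y W (Icc (0 : ℝ) 1)) ∧
        (DiracSystem.IsSolutionV σ₁ σ₂ μ V ∧
          ∀ Y, DiracSystem.IsSolutionV σ₁ σ₂ μ Y → EqOn Y V (Icc (0 : ℝ) 1)) ∧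
        DiracSystem.IsFundamentalSystem (DiracSystem.diracCoeff σ₁ σ₂ μ) W V ∧
        V 0 1 ≠ 0 ∧
        DiracSystem.IsFundamentalSystem (DiracSystem.perturbedCoeff σ₁ σ₂ P μ) Wt Vt ∧
        (∀ x ∈ Icc (0 : ℝ) 1,
          ‖Wt x - (W x + (Complex.exp (Complex.I * μ * x) / μ) •
              DiracSystem.opA₁ P μ W V
                (fun t => Complex.exp (-Complex.I * μ * t) • W t) x)‖
            ≤ ‖Complex.exp (Complex.I * μ * x)‖ * (4 * K ^ 2 / ‖μ‖ ^ 2)) ∧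
        (∀ x ∈ Icc (0 : ℝ) 1,
          ‖Vt x - (V x + (Complex.exp (Complex.I * μ * (1 - x)) / μ) •
              DiracSystem.opA₂ P μ W V
                (fun t => Complex.exp (-Complex.I * μ * (1 - t)) • V t) x)‖
            ≤ ‖Complex.exp (Complex.I * μ * (1 - x))‖ * (4 * K ^ 2 / ‖μ‖ ^ 2)) := by
    intro μ
    by_cases hμ : μ ∈ DiracSystem.halfPlane r ∧ max (max R₁ R₂) (2 * K) < ‖μ‖
    swap
    · exact ⟨0, 0, 0, 0, fun h₁ h₂ => absurd ⟨h₁, h₂⟩ hμ⟩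
    obtain ⟨hμr, hμR⟩ := hμ
    have hμr : -r < μ.im := hμr
    obtain ⟨hμR, hμK⟩ := max_lt_iff.1 hμR
    obtain ⟨hμ₁, hμ₂⟩ := max_lt_iff.1 hμR
    have hμ0 : 0 < ‖μ‖ := hR₁.trans hμ₁
    obtain ⟨W, hW, hWb, -⟩ := H₁ μ hμr hμ₁
    obtain ⟨V, hV, hVb, hv⟩ := H₂ μ hμr hμ₂
    have hv0 : V 0 1 ≠ 0 := norm_pos_iff.1 (lt_of_lt_of_le (by positivity) hv)
    have hexp : ∀ x : ℝ, ‖Complex.exp (Complex.I * μ * (1 - x))‖ =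
        Real.exp (-(μ.im * (1 - x))) := fun x => by
      rw [← DiracSystem.norm_exp_I_mul]; push_cast; rfl
    obtain ⟨Wt, hWt, hWt0, -, hWtb⟩ := DiracSystem.exists_perturbed_solution hσ₁ hσ₂ hP hW hV
      hWb hVb hv (e := fun x : ℝ => Complex.exp (Complex.I * μ * x)) (r := r) (by fun_prop)
      (fun _ => Complex.exp_ne_zero _)
      (fun x hx t ht => by
        rw [DiracSystem.norm_exp_I_mul, DiracSystem.norm_exp_I_mul, ← Real.exp_add, ← Real.exp_add]
        exact Real.exp_le_exp.2
          (by linarith [DiracSystem.abs_mul_sub_le hr hμr hx ht, le_abs_self (μ.im * (x - t))]))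
      hW.1 (fun x hx => by rw [DiracSystem.norm_exp_I_mul]; exact hWb x hx) hK hμ0 hμK.le
    obtain ⟨Vt, hVt, hVt0, hVt1, hVtb⟩ := DiracSystem.exists_perturbed_solution hσ₁ hσ₂ hP hW hV
      hWb hVb hv (e := fun x : ℝ => Complex.exp (Complex.I * μ * (1 - x))) (r := r) (by fun_prop)
      (fun _ => Complex.exp_ne_zero _)
      (fun x hx t ht => by
        rw [hexp, hexp, ← Real.exp_add, ← Real.exp_add]
        exact Real.exp_le_exp.2
          (by linarith [DiracSystem.abs_mul_sub_le hr hμr hx ht, neg_abs_le (μ.im * (x - t))]))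
      hV.1 (fun x hx => by rw [hexp]; exact hVb x hx) hK hμ0 hμK.le
    refine ⟨W, V, Wt, Vt, fun _ _ => ⟨⟨hW, fun Y hY => hW.eqOn hσ₁ hσ₂ hV hv0 hY⟩,
      ⟨hV, fun Y hY => DiracSystem.IsSolutionV.eqOn hσ₁ hσ₂ hW hV hv0 hY⟩,
      DiracSystem.isFundamentalSystem_of_boundary_values hW.1 hV.1 hW.2.1 hV.2.1 hV.2.2, hv0,
      DiracSystem.isFundamentalSystem_of_boundary_values hWt hVt (hWt0.trans hW.2.1)
        (hVt0.trans hV.2.1) (hVt1.trans hV.2.2), ?_, ?_⟩⟩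
    · simpa only [DiracSystem.opA₁_eq_weightedOp, ← Complex.exp_neg, ← neg_mul] using hWtb
    · simpa only [DiracSystem.opA₂_eq_weightedOp, ← Complex.exp_neg, ← neg_mul] using hVtb
  choose W V Wt Vt H using main
  exact ⟨max (max R₁ R₂) (2 * K), lt_max_of_lt_left (lt_max_of_lt_left hR₁), 4 * K ^ 2,
    W, V, Wt, Vt, H⟩
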